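/- Let $k$ be a field. For a Hopf algebra $A$ over $k$, let $\mathcal{YD}_A^A$ be the abelian category of (right-right) Yetter-Drinfeld modules: right $A$-modules $V$ that are also right $A$-comodules and satisfy $$(v \leftarrow a)_{(0)} \otimes (v \leftarrow a)_{(1)} = v_{(0)} \leftarrow a_{(2)} \otimes S(a_{(1)}) v_{(1)} a_{(3)}$$ for all $v\in V$, $a\in A$; the morphisms are the $A$-linear $A$-colinear maps. Let $H^n_{\rm GS}(A,V)={\rm Ext}^n_{\mathcal{YD}_A^A}(k,V)$, where $k$ is the trivial Yetter-Drinfeld module, and $${\rm cd}_{\rm GS}(A)=\sup\{n : H^n_{\rm GS}(A,V)\neq 0 \text{ for some } V\in \mathcal{YD}_A^A\}\in\mathbb N\cup\{\infty\}.$$ A Yetter-Drinfeld module is called free if it is isomorphic to $V\boxtimes A$ for some right $A$-comodule $V$; here $V\boxtimes A$ is the vector space $V\otimes A$ with action $(v\otimes a)\leftarrow b=v\otimes ab$ and coaction $v\otimes a\mapsto v_{(0)}\otimes a_{(2)}\otimes S(a_{(1)})v_{(1)}a_{(3)}$. Let $A$ be a cosemisimple Hopf algebra over $k$ (every right $A$-comodule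 is completely reducible), let $B\subset A$ be a Hopf subalgebra, and assume that there is a Hopf algebra map $\pi:A\to B$ with $\pi|_B={\rm id}_B$. Then $${\rm cd}_{\rm GS}(B)\le{\rm cd}_{\rm GS}(A).$$ Moreover, let $F:\mathcal{YD}_A^A\to\mathcal{YD}_B^B$ be the functor that keeps the underlying vector space, restricts the action to $B$, and replaces the coaction $\alpha$ by $({\rm id}\otimes\pi)\alpha$. Then $F$ sends free Yetter-Drinfeld modules over $A$ to free Yetter-Drinfeld modules over $B$. -/

import Mathlib

open CategoryTheory CategoryTheory.Limits TensorProduct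

universe u

noncomputable section

/-! ### Right comodules and cosemisimplicity -/

/-- A right comodule over a `k`-coalgebra `A`: a `k`-vector space `V` with a coassociative and
counital `k`-linear coaction `V → V ⊗ A`. -/
structure RightComodule (k A : Type u) [Field k] [AddCommGroup A] [Module k A] [Coalgebra k A] where
  carrier : Type u
  [addCommGroup : AddCommGroup carrier]
  [module : Module k carrier]
  coact : carrier →ₗ[k] carrier ⊗[k] A
  coact_assoc : ∀ v, TensorProduct.assoc k carrier A A (coact.rTensor A (coact v)) =
    (Coalgebra.comul (R := k) (A := A)).lTensor carrier (coact v)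
  coact_counit : ∀ v, (Coalgebra.counit (R := k) (A := A)).lTensor carrier (coact v) = v ⊗ₜ[k] 1

attribute [instance] RightComodule.addCommGroup RightComodule.module

/-- A subspace `W` of a comodule `V` is a subcomodule if the coaction of `V` sends `W` into
(the image in `V ⊗ A` of) `W ⊗ A`. -/
def RightComodule.IsSubcomodule {k A : Type u} [Field k] [AddCommGroup A] [Module k A] [Coalgebra k A]
    (V : RightComodule k A) (W : Submodule k V.carrier) : Prop :=
  ∀ w ∈ W, V.coact w ∈ LinearMap.range (W.subtype.rTensor A)

/-- `A` is cosemisimple if every right `A`-comodule is completely reducible, i.e. if every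
subcomodule of a right `A`-comodule is a direct summand as a comodule. -/
def IsCosemisimple (k A : Type u) [Field k] [AddCommGroup A] [Module k A] [Coalgebra k A] : Prop :=
  ∀ (V : RightComodule k A) (W : Submodule k V.carrier), V.IsSubcomodule W →
    ∃ W' : Submodule k V.carrier, V.IsSubcomodule W' ∧ IsCompl W W'

/-! ### Sweedler-type expressions -/

section Twist

variable {k A : Type u} [Field k] [Ring A] [HopfAlgebra k A]

variable (k) in
/-- The iterated comultiplication `a ↦ a₍₁₎ ⊗ (a₍₂₎ ⊗ a₍₃₎)`. -/
def comulTwo : A →ₗ[k] A ⊗[k] (A ⊗[k] A) :=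
  (Coalgebra.comul (R := k) (A := A)).lTensor A ∘ₗ Coalgebra.comul

/-- For a bilinear map `f : V × A → W`, this is the linear map sending `a ⊗ (b ⊗ c)` to the
map `V ⊗ A → W ⊗ A`, `v ⊗ x ↦ f(v, b) ⊗ S(a) x c`. -/
def hopfTwist {V W : Type u} [AddCommGroup V] [Module k V] [AddCommGroup W] [Module k W]
    (f : V →ₗ[k] A →ₗ[k] W) : A ⊗[k] (A ⊗[k] A) →ₗ[k] (V ⊗[k] A →ₗ[k] W ⊗[k] A) :=
  TensorProduct.lift ((TensorProduct.mapBilinear (RingHom.id k) V A W A).compl₁₂ f.flip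
    (TensorProduct.lift (((LinearMap.llcomp k A A A ∘ₗ LinearMap.mul k A).compl₂
      (LinearMap.mul k A).flip) ∘ₗ HopfAlgebra.antipode k)))
    ∘ₗ (TensorProduct.leftComm k A A A).toLinearMap

@[simp]
theorem hopfTwist_tmul {V W : Type u} [AddCommGroup V] [Module k V] [AddCommGroup W] [Module k W]
    (f : V →ₗ[k] A →ₗ[k] W) (a b c x : A) (v : V) :
    hopfTwist f (a ⊗ₜ (b ⊗ₜ c)) (v ⊗ₜ x) =
      f v b ⊗ₜ[k] (HopfAlgebra.antipode k a * x * c) := by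
  simp [hopfTwist, mul_assoc]


theorem rTensor_hopfTwist {V W V' W' : Type u} [AddCommGroup V] [Module k V]
    [AddCommGroup W] [Module k W] [AddCommGroup V'] [Module k V'] [AddCommGroup W'] [Module k W']
    (f : V →ₗ[k] A →ₗ[k] W) (f' : V' →ₗ[k] A →ₗ[k] W') (g : V →ₗ[k] V') (h : W →ₗ[k] W')
    (H : ∀ v a, h (f v a) = f' (g v) a) (t : A ⊗[k] (A ⊗[k] A)) (m : V ⊗[k] A) :
    h.rTensor A (hopfTwist f t m) = hopfTwist f' t (g.rTensor A m) := by
  induction t with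
  | zero => simp
  | add s t hs ht => simp [hs, ht]
  | tmul a y =>
    induction y with
    | zero => simp
    | add s t hs ht => simp [hs, ht, TensorProduct.tmul_add]
    | tmul b c =>
      induction m with
      | zero => simp
      | add s t hs ht => simp [hs, ht]
      | tmul v x => simp [H]

theorem hopfTwist_of_counit {f : k →ₗ[k] A →ₗ[k] k} (hf : ∀ a, f 1 a = Coalgebra.counit a)
    (t : A ⊗[k] A) :
    hopfTwist f ((Coalgebra.comul (R := k) (A := A)).lTensor A t) (1 ⊗ₜ[k] (1 : A)) =
      1 ⊗ₜ[k] (LinearMap.mul' k A ((HopfAlgebra.antipode k).rTensor A t)) := by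
  have key (a : A) (z : A ⊗[k] A) : hopfTwist f (a ⊗ₜ z) (1 ⊗ₜ[k] (1 : A)) = 1 ⊗ₜ[k]
      (HopfAlgebra.antipode k a * TensorProduct.lid k A (Coalgebra.counit.rTensor A z)) := by
    induction z with
    | zero => simp
    | add s t hs ht => simp [hs, ht, TensorProduct.tmul_add, mul_add]
    | tmul b c =>
      simp only [hopfTwist_tmul, hf, LinearMap.rTensor_tmul, TensorProduct.lid_tmul,
        mul_smul_comm, mul_one, TensorProduct.tmul_smul, TensorProduct.smul_tmul',
        smul_eq_mul]
  induction t with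
  | zero => simp
  | add s t hs ht => simp only [map_add, LinearMap.add_apply, hs, ht, TensorProduct.tmul_add]
  | tmul a y => simp [key]

theorem assoc_rTensor_coact {V W : Type u} [AddCommGroup V] [Module k V] [AddCommGroup W]
    [Module k W] {cV : V →ₗ[k] V ⊗[k] A} {cW : W →ₗ[k] W ⊗[k] A} (g : V →ₗ[k] W)
    (H : ∀ v, g.rTensor A (cV v) = cW (g v)) (m : V ⊗[k] A) :
    TensorProduct.assoc k W A A (cW.rTensor A (g.rTensor A m)) =
      g.rTensor (A ⊗[k] A) (TensorProduct.assoc k V A A (cV.rTensor A m)) := by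
  have key (n : V ⊗[k] A) (a : A) : TensorProduct.assoc k W A A (g.rTensor A n ⊗ₜ a) =
      g.rTensor (A ⊗[k] A) (TensorProduct.assoc k V A A (n ⊗ₜ a)) := by
    induction n with
    | zero => simp
    | add s t hs ht => simp [hs, ht, TensorProduct.add_tmul]
    | tmul b c => simp
  induction m with
  | zero => simp
  | add s t hs ht => simp [hs, ht]
  | tmul v a => simp [← H, key]

theorem lTensor_rTensor_comm {V W P Q : Type u} [AddCommGroup V] [Module k V] [AddCommGroup W]
    [Module k W] [AddCommGroup P] [Module k P] [AddCommGroup Q] [Module k Q]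
    (g : V →ₗ[k] W) (h : P →ₗ[k] Q) (m : V ⊗[k] P) :
    h.lTensor W (g.rTensor P m) = g.rTensor Q (h.lTensor V m) := by
  induction m with
  | zero => simp
  | add s t hs ht => simp [hs, ht]
  | tmul v a => simp

end Twist

/-! ### Yetter-Drinfeld modules -/

/-- A (right-right) Yetter-Drinfeld module over the Hopf algebra `A`: a right `A`-comodule `V`
with a right `A`-module structure `v ← a = act v a`, such that
`(v ← a)₍₀₎ ⊗ (v ← a)₍₁₎ = v₍₀₎ ← a₍₂₎ ⊗ S(a₍₁₎) v₍₁₎ a₍₃₎`. -/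
structure YetterDrinfeld (k A : Type u) [Field k] [Ring A] [HopfAlgebra k A] extends
    RightComodule k A where
  act : carrier →ₗ[k] A →ₗ[k] carrier
  act_one : ∀ v, act v 1 = v
  act_mul : ∀ v a b, act v (a * b) = act (act v a) b
  coact_act : ∀ v a, coact (act v a) = hopfTwist act (comulTwo k a) (coact v)

namespace YetterDrinfeld

variable {k A : Type u} [Field k] [Ring A] [HopfAlgebra k A]

/-- Morphisms of Yetter-Drinfeld modules: the `A`-linear and `A`-colinear maps. -/
@[ext]
structure Hom (X Y : YetterDrinfeld k A) where
  lin : X.carrier →ₗ[k] Y.carrier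
  map_act : ∀ v a, lin (X.act v a) = Y.act (lin v) a
  map_coact : ∀ v, lin.rTensor A (X.coact v) = Y.coact (lin v)

instance : Category (YetterDrinfeld k A) where
  Hom := Hom
  id X := ⟨LinearMap.id, by simp, by simp⟩
  comp f g := ⟨g.lin ∘ₗ f.lin, by simp [f.map_act, g.map_act],
    by simp [LinearMap.rTensor_comp, f.map_coact, g.map_coact]⟩

@[ext]
theorem hom_ext {X Y : YetterDrinfeld k A} {f g : X ⟶ Y} (h : ∀ v, f.lin v = g.lin v) : f = g :=
  Hom.ext (LinearMap.ext h)

variable {X Y Z : YetterDrinfeld k A}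

@[simp] theorem id_lin : Hom.lin (𝟙 X) = LinearMap.id := rfl
@[simp] theorem comp_lin (f : X ⟶ Y) (g : Y ⟶ Z) : (f ≫ g).lin = g.lin ∘ₗ f.lin := rfl

/-! #### The additive structure on morphisms -/

instance : Zero (X ⟶ Y) := ⟨⟨0, by simp, by simp⟩⟩
instance : Add (X ⟶ Y) := ⟨fun f g => ⟨f.lin + g.lin, by simp [f.map_act, g.map_act],
  by simp [LinearMap.rTensor_add, f.map_coact, g.map_coact]⟩⟩
instance : Neg (X ⟶ Y) := ⟨fun f => ⟨-f.lin, by simp [f.map_act],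
  by simp [LinearMap.rTensor_neg, f.map_coact]⟩⟩
instance : Sub (X ⟶ Y) := ⟨fun f g => ⟨f.lin - g.lin, by simp [f.map_act, g.map_act],
  by simp [LinearMap.rTensor_sub, f.map_coact, g.map_coact]⟩⟩
instance : SMul ℕ (X ⟶ Y) := ⟨fun n f => ⟨n • f.lin, by simp [f.map_act],
  by simp [← Nat.cast_smul_eq_nsmul k, LinearMap.rTensor_smul, f.map_coact]⟩⟩
instance : SMul ℤ (X ⟶ Y) := ⟨fun n f => ⟨n • f.lin, by simp [f.map_act],
  by simp [← Int.cast_smul_eq_zsmul k, LinearMap.rTensor_smul, f.map_coact]⟩⟩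

@[simp] theorem zero_lin : Hom.lin (0 : X ⟶ Y) = 0 := rfl
@[simp] theorem add_lin (f g : X ⟶ Y) : (f + g).lin = f.lin + g.lin := rfl

instance : AddCommGroup (X ⟶ Y) :=
  Function.Injective.addCommGroup (fun f : X ⟶ Y => f.lin) (fun _ _ => Hom.ext) rfl
    (fun _ _ => rfl) (fun _ => rfl) (fun _ _ => rfl) (fun _ _ => rfl) (fun _ _ => rfl)

instance : Preadditive (YetterDrinfeld k A) where
  add_comp _ _ _ f f' g := by ext; simp
  comp_add _ _ _ f g g' := by ext; simp

/-! #### The trivial module, sums, subobjects and quotients -/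

variable (k A) in
/-- The trivial Yetter-Drinfeld module `k`: `x ← a = ε(a) x`, with coaction `x ↦ x ⊗ 1`. -/
def trivial : YetterDrinfeld k A where
  carrier := k
  coact := (TensorProduct.mk k k A).flip 1
  coact_assoc v := by simp [Algebra.TensorProduct.one_def]
  coact_counit v := by simp
  act := (LinearMap.mul k k).compl₂ Coalgebra.counit
  act_one v := by simp
  act_mul v a b := by simp [mul_assoc]
  coact_act v a := by
    have h := hopfTwist_of_counit (f := (LinearMap.mul k k).compl₂ (Coalgebra.counit (A := A)))
      (by simp) (Coalgebra.comul a)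
    have hv : (v ⊗ₜ[k] (1 : A)) = v • ((1 : k) ⊗ₜ[k] (1 : A)) := by
      simp [TensorProduct.smul_tmul']
    simp only [LinearMap.flip_apply, TensorProduct.mk_apply, comulTwo, LinearMap.comp_apply]
    rw [hv, map_smul, h, HopfAlgebra.mul_antipode_rTensor_comul_apply, Algebra.algebraMap_eq_smul_one]
    simp [TensorProduct.smul_tmul', mul_comm]

/-- The zero Yetter-Drinfeld module. -/
def zeroObj : YetterDrinfeld k A where
  carrier := PUnit
  coact := 0
  coact_assoc v := by simp
  coact_counit v := by rw [show v = 0 from rfl, map_zero, map_zero, TensorProduct.zero_tmul]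
  act := 0
  act_one v := rfl
  act_mul v a b := rfl
  coact_act v a := by simp

/-- The direct sum of two Yetter-Drinfeld modules. -/
def prod (X Y : YetterDrinfeld k A) : YetterDrinfeld k A :=
  let c : X.carrier × Y.carrier →ₗ[k] (X.carrier × Y.carrier) ⊗[k] A :=
    ((LinearMap.inl k X.carrier Y.carrier).rTensor A ∘ₗ X.coact).coprod
      ((LinearMap.inr k X.carrier Y.carrier).rTensor A ∘ₗ Y.coact)
  let m : X.carrier × Y.carrier →ₗ[k] A →ₗ[k] X.carrier × Y.carrier :=
    LinearMap.mk₂ k (fun v a => (X.act v.1 a, Y.act v.2 a)) (by simp) (by simp) (by simp) (by simp)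
  have hl (v : X.carrier) : (LinearMap.inl k X.carrier Y.carrier).rTensor A (X.coact v) =
      c (LinearMap.inl k X.carrier Y.carrier v) := by simp [c]
  have hr (v : Y.carrier) : (LinearMap.inr k X.carrier Y.carrier).rTensor A (Y.coact v) =
      c (LinearMap.inr k X.carrier Y.carrier v) := by simp [c]
  have hc (v : X.carrier × Y.carrier) :
      c v = (LinearMap.inl k X.carrier Y.carrier).rTensor A (X.coact v.1) +
        (LinearMap.inr k X.carrier Y.carrier).rTensor A (Y.coact v.2) := by simp [c]
  { carrier := X.carrier × Y.carrier
    coact := c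
    coact_assoc := fun v => by
      simp only [hc v, map_add, assoc_rTensor_coact _ hl, assoc_rTensor_coact _ hr,
        X.coact_assoc, Y.coact_assoc, lTensor_rTensor_comm]
    coact_counit := fun v => by
      simp [hc v, lTensor_rTensor_comm, X.coact_counit, Y.coact_counit, ← TensorProduct.add_tmul]
    act := m
    act_one := fun v => by simp [m, X.act_one, Y.act_one]
    act_mul := fun v a b => by simp [m, X.act_mul, Y.act_mul]
    coact_act := fun v a => by
      rw [hc v, map_add, ← rTensor_hopfTwist X.act m _ (LinearMap.inl k X.carrier Y.carrier)
        (by simp [m]), ← rTensor_hopfTwist Y.act m _ (LinearMap.inr k X.carrier Y.carrier)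
        (by simp [m]), ← X.coact_act, ← Y.coact_act, hc]
      simp [m] }

/-- Restriction of the Yetter-Drinfeld structure to a subspace stable under the action and the
coaction. -/
def sub (X : YetterDrinfeld k A) (W : Submodule k X.carrier)
    (hact : ∀ w ∈ W, ∀ a, X.act w a ∈ W) (hco : X.IsSubcomodule W) : YetterDrinfeld k A :=
  let e := LinearEquiv.ofInjective (W.subtype.rTensor A)
    (Module.Flat.rTensor_preserves_injective_linearMap _ W.injective_subtype)
  let c : W →ₗ[k] W ⊗[k] A := e.symm.toLinearMap ∘ₗ
    (X.coact ∘ₗ W.subtype).codRestrict (LinearMap.range (W.subtype.rTensor A))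
      (fun w => hco w w.2)
  let m : W →ₗ[k] A →ₗ[k] W :=
    LinearMap.mk₂ k (fun w a => ⟨X.act w a, hact w w.2 a⟩) (by intros; ext; simp)
      (by intros; ext; simp) (by intros; ext; simp) (by intros; ext; simp)
  have hc (w : W) : W.subtype.rTensor A (c w) = X.coact (W.subtype w) := by
    change (e (e.symm _)).1 = _
    rw [e.apply_symm_apply]
    rfl
  have inj (P : Type u) [AddCommGroup P] [Module k P] :
      Function.Injective (W.subtype.rTensor P) :=
    Module.Flat.rTensor_preserves_injective_linearMap _ W.injective_subtype
  { carrier := W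
    coact := c
    coact_assoc := fun w => inj _ (by
      rw [← assoc_rTensor_coact _ hc, ← lTensor_rTensor_comm, hc, X.coact_assoc])
    coact_counit := fun w => inj _ (by
      rw [← lTensor_rTensor_comm, hc, X.coact_counit, LinearMap.rTensor_tmul])
    act := m
    act_one := fun w => Subtype.ext (X.act_one w)
    act_mul := fun w a b => Subtype.ext (X.act_mul w a b)
    coact_act := fun w a => inj _ (by
      rw [rTensor_hopfTwist m X.act W.subtype W.subtype (fun _ _ => rfl), hc, hc,
        ← X.coact_act]
      rfl) }

/-- The quotient of a Yetter-Drinfeld module by a subspace stable under the action and the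
coaction. -/
def quot (X : YetterDrinfeld k A) (W : Submodule k X.carrier)
    (hact : ∀ w ∈ W, ∀ a, X.act w a ∈ W) (hco : X.IsSubcomodule W) : YetterDrinfeld k A :=
  let c : X.carrier ⧸ W →ₗ[k] (X.carrier ⧸ W) ⊗[k] A :=
    W.liftQ (W.mkQ.rTensor A ∘ₗ X.coact) (fun w hw => by
      obtain ⟨t, ht⟩ := hco w hw
      have h0 : W.mkQ ∘ₗ W.subtype = 0 := LinearMap.ext fun w =>
        (Submodule.Quotient.mk_eq_zero W).2 w.2
      rw [LinearMap.mem_ker, LinearMap.comp_apply, ← ht, ← LinearMap.rTensor_comp_apply, h0,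
        LinearMap.rTensor_zero, LinearMap.zero_apply])
  let m : X.carrier ⧸ W →ₗ[k] A →ₗ[k] X.carrier ⧸ W :=
    W.liftQ (X.act.compr₂ W.mkQ) (fun w hw => by
      rw [LinearMap.mem_ker]
      refine LinearMap.ext fun a => ?_
      exact (Submodule.Quotient.mk_eq_zero W).2 (hact w hw a))
  have hc (v : X.carrier) : W.mkQ.rTensor A (X.coact v) = c (W.mkQ v) := rfl
  have hm (v : X.carrier) (a : A) : W.mkQ (X.act v a) = m (W.mkQ v) a := rfl
  { carrier := X.carrier ⧸ W
    coact := c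
    coact_assoc := fun v => by
      obtain ⟨v, rfl⟩ := W.mkQ_surjective v
      rw [← hc, assoc_rTensor_coact _ hc, lTensor_rTensor_comm, X.coact_assoc]
    coact_counit := fun v => by
      obtain ⟨v, rfl⟩ := W.mkQ_surjective v
      rw [← hc, lTensor_rTensor_comm, X.coact_counit, LinearMap.rTensor_tmul]
    act := m
    act_one := fun v => by
      obtain ⟨v, rfl⟩ := W.mkQ_surjective v
      rw [← hm, X.act_one]
    act_mul := fun v a b => by
      obtain ⟨v, rfl⟩ := W.mkQ_surjective v
      rw [← hm, X.act_mul, hm, hm]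
    coact_act := fun v a => by
      obtain ⟨v, rfl⟩ := W.mkQ_surjective v
      rw [← hm, ← hc, X.coact_act, rTensor_hopfTwist X.act m W.mkQ W.mkQ hm, ← hc] }

/-- The inclusion of a subobject. -/
def subIncl (X : YetterDrinfeld k A) (W : Submodule k X.carrier)
    (hact : ∀ w ∈ W, ∀ a, X.act w a ∈ W) (hco : X.IsSubcomodule W) : X.sub W hact hco ⟶ X where
  lin := W.subtype
  map_act _ _ := rfl
  map_coact w := by
    let e := LinearEquiv.ofInjective (W.subtype.rTensor A)
      (Module.Flat.rTensor_preserves_injective_linearMap _ W.injective_subtype)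
    change (e (e.symm _)).1 = _
    rw [e.apply_symm_apply]
    rfl

/-- The projection onto a quotient. -/
def quotProj (X : YetterDrinfeld k A) (W : Submodule k X.carrier)
    (hact : ∀ w ∈ W, ∀ a, X.act w a ∈ W) (hco : X.IsSubcomodule W) : X ⟶ X.quot W hact hco where
  lin := W.mkQ
  map_act _ _ := rfl
  map_coact _ := rfl

theorem ker_act (f : X ⟶ Y) : ∀ w ∈ LinearMap.ker f.lin, ∀ a, X.act w a ∈ LinearMap.ker f.lin :=
  fun w hw a => by
    rw [LinearMap.mem_ker] at hw ⊢
    simp [f.map_act, hw]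

theorem ker_coact (f : X ⟶ Y) : X.IsSubcomodule (LinearMap.ker f.lin) := fun w hw => by
  have hex : Function.Exact (LinearMap.ker f.lin).subtype f.lin := fun v => by simp
  refine (Module.Flat.rTensor_exact A hex _).1 ?_
  rw [f.map_coact, LinearMap.mem_ker.1 hw, map_zero]

theorem range_act (f : X ⟶ Y) :
    ∀ w ∈ LinearMap.range f.lin, ∀ a, Y.act w a ∈ LinearMap.range f.lin := by
  rintro _ ⟨v, rfl⟩ a
  exact ⟨_, f.map_act v a⟩

theorem range_coact (f : X ⟶ Y) : Y.IsSubcomodule (LinearMap.range f.lin) := by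
  rintro _ ⟨v, rfl⟩
  refine ⟨f.lin.rangeRestrict.rTensor A (X.coact v), ?_⟩
  rw [← LinearMap.comp_apply, ← LinearMap.rTensor_comp, ← f.map_coact]
  rfl

/-! #### The category of Yetter-Drinfeld modules is abelian -/

/-- A morphism vanishing on the kernel of a surjection factors through it. -/
theorem exists_desc {q : X ⟶ Y} (hq : Function.Surjective q.lin) (g : X ⟶ Z)
    (h : LinearMap.ker q.lin ≤ LinearMap.ker g.lin) : ∃ l : Y ⟶ Z, q ≫ l = g := by
  let l : Y.carrier →ₗ[k] Z.carrier := (LinearMap.ker q.lin).liftQ g.lin h ∘ₗ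
    (q.lin.quotKerEquivOfSurjective hq).symm.toLinearMap
  have hl (v : X.carrier) : l (q.lin v) = g.lin v := by
    have : (q.lin.quotKerEquivOfSurjective hq).symm (q.lin v) = Submodule.Quotient.mk v := by
      rw [LinearEquiv.symm_apply_eq]
      rfl
    simp [l, this]
  refine ⟨⟨l, fun v a => ?_, fun v => ?_⟩, hom_ext hl⟩
  · obtain ⟨v, rfl⟩ := hq v
    rw [← q.map_act, hl, hl, g.map_act]
  · obtain ⟨v, rfl⟩ := hq v
    rw [← q.map_coact, hl, ← g.map_coact, ← LinearMap.comp_apply, ← LinearMap.rTensor_comp]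
    congr 2
    exact LinearMap.ext hl

/-- A morphism with values in the range of an injection factors through it. -/
theorem exists_lift {i : X ⟶ Y} (hi : Function.Injective i.lin) (g : Z ⟶ Y)
    (h : LinearMap.range g.lin ≤ LinearMap.range i.lin) : ∃ l : Z ⟶ X, l ≫ i = g := by
  let l : Z.carrier →ₗ[k] X.carrier := (LinearEquiv.ofInjective i.lin hi).symm.toLinearMap ∘ₗ
    g.lin.codRestrict (LinearMap.range i.lin) (fun v => h ⟨v, rfl⟩)
  have hl (v : Z.carrier) : i.lin (l v) = g.lin v := by
    change ((LinearEquiv.ofInjective i.lin hi) ((LinearEquiv.ofInjective i.lin hi).symm _)).1 = _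
    rw [LinearEquiv.apply_symm_apply]
    rfl
  refine ⟨⟨l, fun v a => hi ?_, fun v => ?_⟩, hom_ext hl⟩
  · rw [hl, i.map_act, hl, g.map_act]
  · apply Module.Flat.rTensor_preserves_injective_linearMap (M := A) _ hi
    rw [i.map_coact, hl, ← g.map_coact, ← LinearMap.comp_apply, ← LinearMap.rTensor_comp]
    congr 2
    exact LinearMap.ext hl

theorem mono_of_injective {f : X ⟶ Y} (hf : Function.Injective f.lin) : Mono f :=
  ⟨fun _ _ e => hom_ext fun v => hf (congr(($e).lin v))⟩

theorem epi_of_surjective {f : X ⟶ Y} (hf : Function.Surjective f.lin) : Epi f :=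
  ⟨fun _ _ e => hom_ext fun v => by
    obtain ⟨v, rfl⟩ := hf v
    exact congr(($e).lin v)⟩

theorem injective_of_mono (f : X ⟶ Y) [Mono f] : Function.Injective f.lin := by
  rw [← LinearMap.ker_eq_bot, Submodule.eq_bot_iff]
  intro v hv
  have h : X.subIncl _ (ker_act f) (ker_coact f) = 0 := by
    rw [← cancel_mono f, zero_comp]
    exact hom_ext fun w => w.2
  exact congr(($h).lin ⟨v, hv⟩)

theorem surjective_of_epi (f : X ⟶ Y) [Epi f] : Function.Surjective f.lin := by
  rw [← LinearMap.range_eq_top, Submodule.eq_top_iff']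
  intro v
  have h : Y.quotProj _ (range_act f) (range_coact f) = 0 := by
    rw [← cancel_epi f, comp_zero]
    exact hom_ext fun w => (Submodule.Quotient.mk_eq_zero _).2 ⟨w, rfl⟩
  exact (Submodule.Quotient.mk_eq_zero _).1 congr(($h).lin v)

/-- An injection whose range is the kernel of `f` is a kernel of `f`. -/
def isKernel {f : Y ⟶ Z} {i : X ⟶ Y} (w : i ≫ f = 0) (hi : Function.Injective i.lin)
    (h : LinearMap.ker f.lin ≤ LinearMap.range i.lin) : IsLimit (KernelFork.ofι i w) :=
  haveI := mono_of_injective hi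
  have H {W : YetterDrinfeld k A} (g : W ⟶ Y) (hg : g ≫ f = 0) : ∃ l : W ⟶ X, l ≫ i = g :=
    exists_lift hi g fun v hv => h (by
      obtain ⟨v, rfl⟩ := hv
      exact congr(($hg).lin v))
  KernelFork.IsLimit.ofι' _ _ fun g hg => ⟨(H g hg).choose, (H g hg).choose_spec⟩

/-- A surjection whose kernel is the range of `f` is a cokernel of `f`. -/
def isCokernel {f : X ⟶ Y} {q : Y ⟶ Z} (w : f ≫ q = 0) (hq : Function.Surjective q.lin)
    (h : LinearMap.ker q.lin ≤ LinearMap.range f.lin) : IsColimit (CokernelCofork.ofπ q w) :=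
  haveI := epi_of_surjective hq
  have H {W : YetterDrinfeld k A} (g : Y ⟶ W) (hg : f ≫ g = 0) : ∃ l : Z ⟶ W, q ≫ l = g :=
    exists_desc hq g fun v hv => by
      obtain ⟨v, rfl⟩ := h hv
      exact congr(($hg).lin v)
  CokernelCofork.IsColimit.ofπ' _ _ fun g hg => ⟨(H g hg).choose, (H g hg).choose_spec⟩

theorem subIncl_comp (f : X ⟶ Y) : X.subIncl _ (ker_act f) (ker_coact f) ≫ f = 0 :=
  hom_ext fun w => w.2

theorem comp_quotProj (f : X ⟶ Y) : f ≫ Y.quotProj _ (range_act f) (range_coact f) = 0 :=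
  hom_ext fun w => (Submodule.Quotient.mk_eq_zero _).2 ⟨w, rfl⟩

instance : HasKernels (YetterDrinfeld k A) where
  has_limit f := ⟨⟨⟨_, isKernel (subIncl_comp f) Subtype.val_injective
    (Submodule.range_subtype _).ge⟩⟩⟩

instance : HasCokernels (YetterDrinfeld k A) where
  has_colimit f := ⟨⟨⟨_, isCokernel (comp_quotProj f) (Submodule.mkQ_surjective _)
    (Submodule.ker_mkQ _).le⟩⟩⟩

instance : IsNormalMonoCategory (YetterDrinfeld k A) where
  normalMonoOfMono f _ := ⟨⟨_, _, comp_quotProj f, isKernel _ (injective_of_mono f)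
    (Submodule.ker_mkQ _).le⟩⟩

instance : IsNormalEpiCategory (YetterDrinfeld k A) where
  normalEpiOfEpi f _ := ⟨⟨_, _, subIncl_comp f, isCokernel _ (surjective_of_epi f)
    (Submodule.range_subtype _).ge⟩⟩

instance : HasZeroObject (YetterDrinfeld k A) where
  zero := ⟨zeroObj,
    { unique_to := fun X => ⟨⟨⟨0⟩, fun f => hom_ext fun v => by
        rw [show v = 0 from rfl, map_zero, map_zero]⟩⟩
      unique_from := fun X => ⟨⟨⟨0⟩, fun f => hom_ext fun v => rfl⟩⟩ }⟩

theorem fst_aux (X Y : YetterDrinfeld k A) (v : X.carrier) (w : Y.carrier) :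
    (LinearMap.fst k X.carrier Y.carrier).rTensor A
      ((LinearMap.inl k X.carrier Y.carrier).rTensor A (X.coact v) +
        (LinearMap.inr k X.carrier Y.carrier).rTensor A (Y.coact w)) = X.coact v := by
  rw [map_add, ← LinearMap.rTensor_comp_apply, ← LinearMap.rTensor_comp_apply,
    LinearMap.fst_comp_inl, LinearMap.fst_comp_inr]
  simp

theorem snd_aux (X Y : YetterDrinfeld k A) (v : X.carrier) (w : Y.carrier) :
    (LinearMap.snd k X.carrier Y.carrier).rTensor A
      ((LinearMap.inl k X.carrier Y.carrier).rTensor A (X.coact v) +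
        (LinearMap.inr k X.carrier Y.carrier).rTensor A (Y.coact w)) = Y.coact w := by
  rw [map_add, ← LinearMap.rTensor_comp_apply, ← LinearMap.rTensor_comp_apply,
    LinearMap.snd_comp_inl, LinearMap.snd_comp_inr]
  simp

/-- The direct sum as a biproduct. -/
def bicone (X Y : YetterDrinfeld k A) : BinaryBicone X Y where
  pt := X.prod Y
  inl :=
    { lin := LinearMap.inl k X.carrier Y.carrier
      map_act := fun v a => Prod.ext rfl (by
        change 0 = Y.act 0 a
        simp)
      map_coact := fun v => by
        change _ = (LinearMap.inl k X.carrier Y.carrier).rTensor A (X.coact v) +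
          (LinearMap.inr k X.carrier Y.carrier).rTensor A (Y.coact 0)
        rw [map_zero, map_zero, add_zero]
        rfl }
  inr :=
    { lin := LinearMap.inr k X.carrier Y.carrier
      map_act := fun v a => Prod.ext (by
        change 0 = X.act 0 a
        simp) rfl
      map_coact := fun v => by
        change _ = (LinearMap.inl k X.carrier Y.carrier).rTensor A (X.coact 0) +
          (LinearMap.inr k X.carrier Y.carrier).rTensor A (Y.coact v)
        rw [map_zero, map_zero, zero_add]
        rfl }
  fst :=
    { lin := LinearMap.fst k X.carrier Y.carrier
      map_act := fun _ _ => rfl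
      map_coact := fun v => by
        exact fst_aux X Y v.1 v.2 }
  snd :=
    { lin := LinearMap.snd k X.carrier Y.carrier
      map_act := fun _ _ => rfl
      map_coact := fun v => by
        exact snd_aux X Y v.1 v.2 }
  inl_fst := hom_ext fun v => rfl
  inl_snd := hom_ext fun v => rfl
  inr_fst := hom_ext fun v => rfl
  inr_snd := hom_ext fun v => rfl

instance : HasBinaryBiproducts (YetterDrinfeld k A) where
  has_binary_biproduct X Y := hasBinaryBiproduct_of_total (bicone X Y)
    (hom_ext fun v => by
      change ((v.1, 0) + (0, v.2) : X.carrier × Y.carrier) = (v.1, v.2)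
      simp)

instance : Abelian (YetterDrinfeld k A) where
  has_finite_products := hasFiniteProducts_of_has_binary_and_terminal

/-! #### Free Yetter-Drinfeld modules and the functor induced by a projection -/

/-- A Yetter-Drinfeld module is free if it is isomorphic to `V ⊠ A` for some right `A`-comodule `V`,
i.e. to the vector space `V ⊗ A` with action `(v ⊗ a) ← b = v ⊗ ab` and coaction
`v ⊗ a ↦ v₍₀₎ ⊗ a₍₂₎ ⊗ S(a₍₁₎) v₍₁₎ a₍₃₎`. -/
def IsFree (X : YetterDrinfeld k A) : Prop :=
  ∃ (V : RightComodule k A) (e : V.carrier ⊗[k] A ≃ₗ[k] X.carrier),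
    (∀ v a b, X.act (e (v ⊗ₜ a)) b = e (v ⊗ₜ (a * b))) ∧
    (∀ v a, X.coact (e (v ⊗ₜ a)) = e.toLinearMap.rTensor A
      (hopfTwist (TensorProduct.mk k V.carrier A) (comulTwo k a) (V.coact v)))

section Induced

variable {B : Type u} [Ring B] [HopfAlgebra k B] (ι : B →ₐc[k] A) (π : A →ₐc[k] B)

theorem proj_antipode (hπ : ∀ b, π (ι b) = b) (b : B) :
    π (HopfAlgebra.antipode k (ι b)) = HopfAlgebra.antipode k b := by
  have key (z : B ⊗[k] B) : π (LinearMap.mul' k A ((HopfAlgebra.antipode k).rTensor A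
      (TensorProduct.map (ι : B →ₗ[k] A) (ι : B →ₗ[k] A) z))) =
      LinearMap.mul' k B (TensorProduct.map ((π : A →ₗ[k] B) ∘ₗ HopfAlgebra.antipode k ∘ₗ
        (ι : B →ₗ[k] A)) LinearMap.id z) := by
    induction z with
    | zero => simp
    | add s t hs ht => simp only [map_add, hs, ht]
    | tmul a b => simp [hπ]
  have h : WithConv.toConv ((π : A →ₗ[k] B) ∘ₗ HopfAlgebra.antipode k ∘ₗ (ι : B →ₗ[k] A)) =
      WithConv.toConv (HopfAlgebra.antipode k) := by
    refine left_inv_eq_right_inv (a := WithConv.toConv LinearMap.id) ?_ LinearMap.id_mul_antipode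
    ext b
    rw [LinearMap.convMul_apply, LinearMap.convOne_apply]
    refine (key _).symm.trans ?_
    rw [CoalgHomClass.map_comp_comul_apply, HopfAlgebra.mul_antipode_rTensor_comul_apply,
      AlgHomClass.commutes, CoalgHomClass.counit_comp_apply]
  exact LinearMap.congr_fun (WithConv.toConv_injective h) b

theorem lTensor_hopfTwist (hπ : ∀ b, π (ι b) = b) {V W : Type u} [AddCommGroup V] [Module k V]
    [AddCommGroup W] [Module k W] (f : V →ₗ[k] A →ₗ[k] W) (t : B ⊗[k] (B ⊗[k] B))
    (m : V ⊗[k] A) :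
    (π : A →ₗ[k] B).lTensor W (hopfTwist f (TensorProduct.map (ι : B →ₗ[k] A)
        (TensorProduct.map (ι : B →ₗ[k] A) (ι : B →ₗ[k] A)) t) m) =
      hopfTwist (f.compl₂ (ι : B →ₗ[k] A)) t ((π : A →ₗ[k] B).lTensor V m) := by
  induction t with
  | zero => simp
  | add s t hs ht => simp only [map_add, LinearMap.add_apply, hs, ht]
  | tmul a y =>
    induction y with
    | zero => simp
    | add s t hs ht =>
      simp only [map_add, LinearMap.add_apply, hs, ht, TensorProduct.tmul_add]
    | tmul b c =>
      induction m with
      | zero => simp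
      | add s t hs ht => simp only [map_add, hs, ht]
      | tmul v x => simp [hπ, proj_antipode ι π hπ]

theorem comulTwo_map (b : B) : comulTwo k (ι b) = TensorProduct.map (ι : B →ₗ[k] A)
    (TensorProduct.map (ι : B →ₗ[k] A) (ι : B →ₗ[k] A)) (comulTwo k b) := by
  have key (z : B ⊗[k] B) : (Coalgebra.comul (R := k) (A := A)).lTensor A
      (TensorProduct.map (ι : B →ₗ[k] A) (ι : B →ₗ[k] A) z) = TensorProduct.map (ι : B →ₗ[k] A)
      (TensorProduct.map (ι : B →ₗ[k] A) (ι : B →ₗ[k] A))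
        ((Coalgebra.comul (R := k) (A := B)).lTensor B z) := by
    induction z with
    | zero => simp
    | add s t hs ht => simp only [map_add, hs, ht]
    | tmul a b => simp [← CoalgHomClass.map_comp_comul_apply]
  simp only [comulTwo, LinearMap.comp_apply]
  rw [← key, CoalgHomClass.map_comp_comul_apply]

theorem assoc_lTensor_coact {V : Type u} [AddCommGroup V] [Module k V] (c : V →ₗ[k] V ⊗[k] A)
    (m : V ⊗[k] A) :
    TensorProduct.assoc k V B B (((π : A →ₗ[k] B).lTensor V ∘ₗ c).rTensor B
      ((π : A →ₗ[k] B).lTensor V m)) =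
      (TensorProduct.map (π : A →ₗ[k] B) (π : A →ₗ[k] B)).lTensor V
        (TensorProduct.assoc k V A A (c.rTensor A m)) := by
  have key (n : V ⊗[k] A) (a : A) :
      TensorProduct.assoc k V B B ((π : A →ₗ[k] B).lTensor V n ⊗ₜ π a) =
      (TensorProduct.map (π : A →ₗ[k] B) (π : A →ₗ[k] B)).lTensor V
        (TensorProduct.assoc k V A A (n ⊗ₜ a)) := by
    induction n with
    | zero => simp
    | add s t hs ht => simp only [map_add, hs, ht, TensorProduct.add_tmul]
    | tmul b c => simp
  induction m with
  | zero => simp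
  | add s t hs ht => simp only [map_add, hs, ht]
  | tmul v a => simpa using key (c v) a

theorem comul_lTensor {V : Type u} [AddCommGroup V] [Module k V] (m : V ⊗[k] A) :
    (Coalgebra.comul (R := k) (A := B)).lTensor V ((π : A →ₗ[k] B).lTensor V m) =
      (TensorProduct.map (π : A →ₗ[k] B) (π : A →ₗ[k] B)).lTensor V
        ((Coalgebra.comul (R := k) (A := A)).lTensor V m) := by
  induction m with
  | zero => simp
  | add s t hs ht => simp only [map_add, hs, ht]
  | tmul v a => simp [← CoalgHomClass.map_comp_comul_apply]

theorem counit_lTensor {V : Type u} [AddCommGroup V] [Module k V] (m : V ⊗[k] A) :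
    (Coalgebra.counit (R := k) (A := B)).lTensor V ((π : A →ₗ[k] B).lTensor V m) =
      (Coalgebra.counit (R := k) (A := A)).lTensor V m := by
  induction m with
  | zero => simp
  | add s t hs ht => simp only [map_add, hs, ht]
  | tmul v a => simp

/-- For Hopf algebra maps `ι : B → A` and `π : A → B` with `π ∘ ι = id`, and a Yetter-Drinfeld
module `X` over `A`, the Yetter-Drinfeld module over `B` with the same underlying vector space,
with the action restricted along `ι`, and with coaction `(id ⊗ π) α`, where `α` is the coaction
of `X`. -/
def inducedObj (hπ : ∀ b, π (ι b) = b) (X : YetterDrinfeld k A) : YetterDrinfeld k B :=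
    { carrier := X.carrier
      coact := (π : A →ₗ[k] B).lTensor X.carrier ∘ₗ X.coact
      coact_assoc := fun v => by
        rw [LinearMap.comp_apply, assoc_lTensor_coact, X.coact_assoc, comul_lTensor]
      coact_counit := fun v => by
        rw [LinearMap.comp_apply, counit_lTensor, X.coact_counit]
      act := X.act.compl₂ (ι : B →ₗ[k] A)
      act_one := fun v => by simp [X.act_one]
      act_mul := fun v a b => by simp [X.act_mul]
      coact_act := fun v b => by
        rw [LinearMap.comp_apply, LinearMap.comp_apply, ← lTensor_hopfTwist ι π hπ,
          ← comulTwo_map, ← X.coact_act]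
        rfl }

/-- The functor `X ↦ inducedObj ι π hπ X`, which keeps the underlying linear maps. -/
def inducedFunctor (hπ : ∀ b, π (ι b) = b) : YetterDrinfeld k A ⥤ YetterDrinfeld k B where
  obj X := inducedObj ι π hπ X
  map {X Y} f :=
    { lin := f.lin
      map_act := fun v b => f.map_act v (ι b)
      map_coact := fun v => (lTensor_rTensor_comm f.lin (π : A →ₗ[k] B) (X.coact v)).symm.trans
        (congrArg _ (f.map_coact v)) }

end Induced

end YetterDrinfeld

/-! ### Gerstenhaber-Schack cohomology -/

section GerstenhaberSchack

variable (k : Type u) {A : Type u} [Field k] [Ring A] [HopfAlgebra k A]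

/-- The Gerstenhaber-Schack cohomology `Hⁿ(A, V) = Extⁿ(k, V)`, the `Ext` group being taken in the
abelian category of Yetter-Drinfeld modules over `A`. -/
def gsCohomology (V : YetterDrinfeld k A) (n : ℕ) : Type (u + 1) :=
  letI := HasExt.standard (YetterDrinfeld k A)
  Abelian.Ext.{u + 1} (YetterDrinfeld.trivial k A) V n

instance (V : YetterDrinfeld k A) (n : ℕ) : AddCommGroup (gsCohomology k V n) :=
  letI := HasExt.standard (YetterDrinfeld k A)
  inferInstanceAs (AddCommGroup (Abelian.Ext.{u + 1} (YetterDrinfeld.trivial k A) V n))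

variable (A) in
/-- The Gerstenhaber-Schack cohomological dimension of `A`:
`sup {n | Hⁿ(A, V) ≠ 0 for some Yetter-Drinfeld module V}`, in `ℕ ∪ {∞}`. -/
def gsDim : ℕ∞ :=
  sSup {d | ∃ n : ℕ, d = n ∧ ∃ V : YetterDrinfeld k A, Nontrivial (gsCohomology k V n)}

end GerstenhaberSchack

end

noncomputable section

/-! ### Convolution identities in Hopf algebras -/

section Convolution

open WithConv Algebra.TensorProduct

variable {k A B C : Type u} [Field k] [Ring A] [HopfAlgebra k A] [Ring B] [HopfAlgebra k B]
  [Ring C] [Algebra k C]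

/-! Freeness rests on Radford's decomposition. Let `R ⊂ A` be the coinvariants, `r₍₁₎ ⊗ π(r₍₂₎) = r
⊗ 1`. Multiplication `R ⊗ B → A`, `r ⊗ b ↦ r ι(b)`, is bijective (`coinvEquiv`), so `V ⊗ A ≅ (V ⊗ R)
⊗ B` as right `B`-modules. For `r ∈ R` the last factor of the induced coaction disappears, since
`π(r₍₃₎)` becomes `1`: `v ⊗ r ↦ v₍₀₎ ⊗ r₍₂₎ ⊗ π(S(r₍₁₎)) π(v₍₁₎)`, and `Δ(R) ⊂ A ⊗ R`. Hence `U = V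
⊗ R` is a `B`-subcomodule (`lTensor_hopfTwist_mk_mem`). A Yetter-Drinfeld module freely generated
over `B` by a subcomodule `U` is `U ⊠ B`, because the compatibility axiom determines the coaction
from its values on `U` (`isFree_of_colinear`).

For the dimensions, `V ↦ V ⊠ A` is left adjoint to the forgetful functor to comodules. If `A` is
cosemisimple, epimorphisms split colinearly, so free modules are projective (`IsFree.projective`),
and every module is a quotient of a free one (`exists_free_epi`). Cosemisimplicity passes to the
retract `B`. The induced functor `F` leaves linear maps unchanged, hence is exact; it sends free
modules to projective ones, so it does not increase projective dimension
(`hasProjectiveDimensionLT_inducedObj`). As `F(k) ≅ k` and the Gerstenhaber-Schack dimension bounds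
the projective dimension of `k`, the inequality follows.

The long Sweedler computations, notably coassociativity of `V ⊠ A` and the properties of `R`, are
carried out in convolution algebras `Hom(A, C)`, where they reduce to associativity and cancellation
of inverses. -/

theorem conv_algHom_mul_antipode (f : A →ₐ[k] C) :
    toConv f.toLinearMap * toConv (f.toLinearMap ∘ₗ HopfAlgebra.antipode k) = 1 := by
  have h := LinearMap.algHom_comp_convMul_distrib (R := k) f (toConv LinearMap.id)
    (toConv (HopfAlgebra.antipode k (A := A)))
  rw [LinearMap.id_mul_antipode] at h
  refine (congrArg toConv h).symm.trans ?_
  ext a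
  simp

theorem conv_antipode_mul_algHom (f : A →ₐ[k] C) :
    toConv (f.toLinearMap ∘ₗ HopfAlgebra.antipode k) * toConv f.toLinearMap = 1 := by
  have h := LinearMap.algHom_comp_convMul_distrib (R := k) f
    (toConv (HopfAlgebra.antipode k (A := A))) (toConv LinearMap.id)
  rw [LinearMap.antipode_mul_id] at h
  refine (congrArg toConv h).symm.trans ?_
  ext a
  simp

/-- Bialgebra maps between Hopf algebras commute with the antipodes. -/
theorem map_antipode (f : A →ₐc[k] B) (a : A) :
    f (HopfAlgebra.antipode k a) = HopfAlgebra.antipode k (f a) := by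
  have h : toConv ((f : A →ₐ[k] B).toLinearMap ∘ₗ HopfAlgebra.antipode k) =
      toConv (HopfAlgebra.antipode k ∘ₗ (f : A →ₐ[k] B).toLinearMap) := by
    -- Both maps are convolution inverses of `f`: one by composing `S * id = 1` with `f` on the
    -- left, the other by composing `id * S = 1` with `f` on the right.
    refine left_inv_eq_right_inv (conv_antipode_mul_algHom (f : A →ₐ[k] B)) ?_
    have h := LinearMap.convMul_comp_coalgHom_distrib (R := k) (toConv LinearMap.id)
      (toConv (HopfAlgebra.antipode k (A := B))) (f : A →ₗc[k] B)
    rw [LinearMap.id_mul_antipode] at h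
    refine (congrArg toConv h).symm.trans ?_
    ext a
    simp
  exact LinearMap.congr_fun (toConv_injective h) a

theorem conv_includeLeft_mul_includeRight {P Q : Type u} [Ring P] [Algebra k P] [Ring Q]
    [Algebra k Q] (f : A →ₗ[k] P) (g : A →ₗ[k] Q) :
    toConv ((includeLeft : P →ₐ[k] P ⊗[k] Q).toLinearMap ∘ₗ f) *
      toConv ((includeRight : Q →ₐ[k] P ⊗[k] Q).toLinearMap ∘ₗ g) =
        toConv (TensorProduct.map f g ∘ₗ Coalgebra.comul) := by
  ext a
  change LinearMap.mul' k _ (TensorProduct.map _ _ _) = TensorProduct.map f g _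
  generalize (Coalgebra.comul a : A ⊗[k] A) = t
  induction t with
  | zero => simp
  | add s t hs ht => simp only [map_add, hs, ht]
  | tmul a b => simp

/-- The antipode is anticomultiplicative, in convolution form. -/
theorem comul_comp_antipode :
    toConv (Coalgebra.comul (R := k) ∘ₗ HopfAlgebra.antipode k (A := A)) =
      toConv ((includeRight : A →ₐ[k] A ⊗[k] A).toLinearMap ∘ₗ HopfAlgebra.antipode k) *
      toConv ((includeLeft : A →ₐ[k] A ⊗[k] A).toLinearMap ∘ₗ HopfAlgebra.antipode k) := by
  symm
  -- Both sides invert `Δ`. Since `Δ` is the product of the two inclusions `A → A ⊗ A`, its inverse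
  -- is the product of their inverses in reverse order.
  refine left_inv_eq_right_inv (a := toConv Coalgebra.comul) ?_ LinearMap.comul_right_inv
  have h : toConv (Coalgebra.comul (R := k) (A := A)) =
      toConv ((includeLeft : A →ₐ[k] A ⊗[k] A).toLinearMap) *
        toConv ((includeRight : A →ₐ[k] A ⊗[k] A).toLinearMap) := by
    have := conv_includeLeft_mul_includeRight (k := k) (LinearMap.id (M := A)) LinearMap.id
    rw [TensorProduct.map_id] at this
    exact this.symm
  rw [h, mul_assoc, ← mul_assoc _ (toConv includeLeft.toLinearMap),
    conv_antipode_mul_algHom, one_mul, conv_antipode_mul_algHom]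

/-- Lets a threefold convolution be compared with a `hopfTwist` by induction on the tensor `comulTwo
k a`. -/
theorem conv_mul_mul_apply (f g h : WithConv (A →ₗ[k] C)) (a : A) :
    (f * (g * h)) a = LinearMap.mul' k C (TensorProduct.map f.ofConv
      (LinearMap.mul' k C ∘ₗ TensorProduct.map g.ofConv h.ofConv) (comulTwo k a)) := by
  rw [LinearMap.convMul_apply, comulTwo, LinearMap.comp_apply, LinearMap.lTensor,
    ← LinearMap.comp_apply (TensorProduct.map _ _) (TensorProduct.map _ _),
    ← TensorProduct.map_comp]
  rfl

/-- The constant maps of the convolution algebra. -/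
def convConst (c : C) : WithConv (A →ₗ[k] C) :=
  toConv (LinearMap.toSpanSingleton k C c ∘ₗ Coalgebra.counit)

theorem convConst_mul_apply (c : C) (f : WithConv (A →ₗ[k] C)) (a : A) :
    (convConst c * f : WithConv (A →ₗ[k] C)) a = c * f a := by
  have h (t : A ⊗[k] A) : LinearMap.mul' k C
      (TensorProduct.map (convConst (A := A) (k := k) c).ofConv f.ofConv t) =
      c * f (TensorProduct.lid k A (Coalgebra.counit.rTensor A t)) := by
    induction t with
    | zero => simp
    | add s t hs ht => simp only [map_add, hs, ht, mul_add]
    | tmul a b => simp [convConst]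
  rw [LinearMap.convMul_apply, h, Coalgebra.rTensor_counit_comul]
  simp

theorem mul_convConst_apply (c : C) (f : WithConv (A →ₗ[k] C)) (a : A) :
    (f * convConst c : WithConv (A →ₗ[k] C)) a = f a * c := by
  have h (t : A ⊗[k] A) : LinearMap.mul' k C
      (TensorProduct.map f.ofConv (convConst (A := A) (k := k) c).ofConv t) =
      f (TensorProduct.rid k A (Coalgebra.counit.lTensor A t)) * c := by
    induction t with
    | zero => simp
    | add s t hs ht => simp only [map_add, hs, ht, add_mul]
    | tmul a b => simp [convConst]
  rw [LinearMap.convMul_apply, h, Coalgebra.lTensor_counit_comul]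
  simp

theorem convConst_comm {c : C} {f : WithConv (A →ₗ[k] C)} (h : ∀ a, Commute c (f a)) :
    convConst c * f = f * convConst c := by
  ext a
  rw [convConst_mul_apply, mul_convConst_apply, (h a).eq]

theorem convConst_mul (c d : C) :
    (convConst (c * d) : WithConv (A →ₗ[k] C)) = convConst c * convConst d := by
  ext a
  rw [convConst_mul_apply]
  simp [convConst]

end Convolution

/-! ### Free Yetter-Drinfeld modules -/

section Free

open WithConv Algebra.TensorProduct

variable {k A : Type u} [Field k] [Ring A] [HopfAlgebra k A]

/-- The map sending `a ⊗ (b ⊗ c)` to `x ↦ b ⊗ S(a) x c`. -/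
def sandwich : A ⊗[k] (A ⊗[k] A) →ₗ[k] A →ₗ[k] A ⊗[k] A :=
  (LinearMap.llcomp k A (k ⊗[k] A) (A ⊗[k] A)).flip (TensorProduct.mk k k A 1) ∘ₗ
    hopfTwist (LinearMap.lsmul k A)

@[simp]
theorem sandwich_tmul (a b c x : A) :
    sandwich (k := k) (a ⊗ₜ (b ⊗ₜ c)) x = b ⊗ₜ (HopfAlgebra.antipode k a * x * c) := by
  simp [sandwich]

/-- The factor `V` is inert in the twist, so the comodule axioms of `V ⊠ A` reduce to identities
between tensor powers of `A`. -/
theorem hopfTwist_mk_tmul {V : Type u} [AddCommGroup V] [Module k V] (t : A ⊗[k] (A ⊗[k] A))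
    (v : V) (x : A) : hopfTwist (TensorProduct.mk k V A) t (v ⊗ₜ x) =
      (TensorProduct.assoc k V A A).symm (v ⊗ₜ sandwich t x) := by
  induction t with
  | zero => simp
  | add s t hs ht => simp only [map_add, LinearMap.add_apply, hs, ht, TensorProduct.tmul_add]
  | tmul a y =>
    induction y with
    | zero => simp
    | add s t hs ht =>
      simp only [map_add, LinearMap.add_apply, hs, ht, TensorProduct.tmul_add]
    | tmul b c => simp

theorem sandwich_comulTwo (a x : A) :
    sandwich (comulTwo k a) x =
      (toConv (includeRight.toLinearMap ∘ₗ HopfAlgebra.antipode k) *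
        (convConst (1 ⊗ₜ x) * (toConv (includeLeft : A →ₐ[k] A ⊗[k] A).toLinearMap *
          toConv (includeRight : A →ₐ[k] A ⊗[k] A).toLinearMap)) :
        WithConv (A →ₗ[k] A ⊗[k] A)) a := by
  rw [← mul_assoc (convConst _), conv_mul_mul_apply]
  generalize comulTwo k a = t
  induction t with
  | zero => simp
  | add s t hs ht => simp only [map_add, LinearMap.add_apply, hs, ht]
  | tmul a y =>
    induction y with
    | zero => simp
    | add s t hs ht => simp only [map_add, LinearMap.add_apply, hs, ht, TensorProduct.tmul_add]
    | tmul b c =>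
      have h := convConst_mul_apply (k := k) ((1 : A) ⊗ₜ[k] x)
        (toConv (includeLeft : A →ₐ[k] A ⊗[k] A).toLinearMap) b
      simp only [sandwich_tmul, TensorProduct.map_tmul, LinearMap.comp_apply,
        LinearMap.mul'_apply]
      erw [h]
      simp [mul_assoc]

/-- The map `a ↦ a₍₃₎ ⊗ (S(a₍₂₎) x a₍₄₎ ⊗ S(a₍₁₎) y a₍₅₎)`, for `z = x ⊗ y`. -/
def doubleSandwich (z : A ⊗[k] A) : WithConv (A →ₗ[k] A ⊗[k] (A ⊗[k] A)) :=
  toConv ((includeRight.comp includeRight : A →ₐ[k] A ⊗[k] (A ⊗[k] A)).toLinearMap ∘ₗ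
    HopfAlgebra.antipode k) *
  (toConv ((includeRight.comp includeLeft : A →ₐ[k] A ⊗[k] (A ⊗[k] A)).toLinearMap ∘ₗ
    HopfAlgebra.antipode k) *
  (convConst (1 ⊗ₜ z) *
  (toConv (includeLeft : A →ₐ[k] A ⊗[k] (A ⊗[k] A)).toLinearMap *
  (toConv (includeRight.comp includeLeft : A →ₐ[k] A ⊗[k] (A ⊗[k] A)).toLinearMap *
  toConv (includeRight.comp includeRight : A →ₐ[k] A ⊗[k] (A ⊗[k] A)).toLinearMap))))

/-- Composition with an algebra map distributes over convolution. Both sides of coassociativity use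
this, with `J = id ⊗ Δ` and with `J` the inclusion of the first two tensor factors. -/
theorem algHom_comp_sandwich {C : Type u} [Ring C] [Algebra k C] (J : A ⊗[k] A →ₐ[k] C) (x : A) :
    (toConv (J.toLinearMap ∘ₗ sandwich.flip x ∘ₗ comulTwo k) : WithConv (A →ₗ[k] C)) =
      toConv ((J.comp includeRight).toLinearMap ∘ₗ HopfAlgebra.antipode k) *
        (convConst (J (1 ⊗ₜ x)) * (toConv (J.comp includeLeft).toLinearMap *
          toConv (J.comp includeRight).toLinearMap)) := by
  have h : sandwich.flip x ∘ₗ comulTwo k = (toConv (includeRight.toLinearMap ∘ₗ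
      HopfAlgebra.antipode k) * (convConst (1 ⊗ₜ x) *
        (toConv (includeLeft : A →ₐ[k] A ⊗[k] A).toLinearMap *
          toConv (includeRight : A →ₐ[k] A ⊗[k] A).toLinearMap)) :
        WithConv (A →ₗ[k] A ⊗[k] A)).ofConv :=
    LinearMap.ext fun a => by
      rw [LinearMap.comp_apply, LinearMap.flip_apply, sandwich_comulTwo]
  have hc : J.toLinearMap ∘ₗ (convConst (1 ⊗ₜ x) : WithConv (A →ₗ[k] A ⊗[k] A)).ofConv =
      (convConst (J (1 ⊗ₜ x)) : WithConv (A →ₗ[k] C)).ofConv := by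
    ext a
    simp [convConst]
  rw [h, LinearMap.algHom_comp_convMul_distrib, LinearMap.algHom_comp_convMul_distrib,
    LinearMap.algHom_comp_convMul_distrib, hc]
  rfl

/-- One side of coassociativity: apply the algebra map `id ⊗ Δ`, then split `Δ` into the two
inclusions and `Δ ∘ S` into their antipodes in reverse order. -/
theorem lTensor_comul_sandwich (a x : A) :
    (Coalgebra.comul (R := k) (A := A)).lTensor A (sandwich (comulTwo k a) x) =
      doubleSandwich (Coalgebra.comul x) a := by
  have h := algHom_comp_sandwich (k := k)
    (Algebra.TensorProduct.map (AlgHom.id k A) (Bialgebra.comulAlgHom k A)) x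
  have h1 := comul_comp_antipode (k := k) (A := A)
  have h2 : toConv (Coalgebra.comul (R := k) (A := A)) =
      toConv ((includeLeft : A →ₐ[k] A ⊗[k] A).toLinearMap) *
        toConv ((includeRight : A →ₐ[k] A ⊗[k] A).toLinearMap) := by
    have := conv_includeLeft_mul_includeRight (k := k) (LinearMap.id (M := A)) LinearMap.id
    rw [TensorProduct.map_id] at this
    exact this.symm
  have e1 := congrArg toConv ((congrArg (LinearMap.comp
    (includeRight : A ⊗[k] A →ₐ[k] A ⊗[k] (A ⊗[k] A)).toLinearMap)
    (congrArg ofConv h1)).trans (LinearMap.algHom_comp_convMul_distrib _ _ _))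
  have e2 := congrArg toConv ((congrArg (LinearMap.comp
    (includeRight : A ⊗[k] A →ₐ[k] A ⊗[k] (A ⊗[k] A)).toLinearMap)
    (congrArg ofConv h2)).trans (LinearMap.algHom_comp_convMul_distrib _ _ _))
  have e3 : ((Algebra.TensorProduct.map (AlgHom.id k A) (Bialgebra.comulAlgHom k A)).comp
      includeRight).toLinearMap =
      (includeRight : A ⊗[k] A →ₐ[k] A ⊗[k] (A ⊗[k] A)).toLinearMap ∘ₗ
        Coalgebra.comul (R := k) (A := A) := by
    ext a
    simp
  have e4 : (Algebra.TensorProduct.map (AlgHom.id k A) (Bialgebra.comulAlgHom k A)).comp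
      includeLeft = (includeLeft : A →ₐ[k] A ⊗[k] (A ⊗[k] A)) := by
    ext a
    simp
  rw [e3, e4, e2, LinearMap.comp_assoc] at h
  refine (LinearMap.congr_fun (congrArg ofConv h) a).trans ?_
  erw [e1]
  rw [doubleSandwich, mul_assoc]
  simp
  rfl

/-- The other side of coassociativity: coacting again on the middle leg `a₍₂₎` nests one sandwich
inside another. -/
theorem hopfTwist_hopfTwist_mk {V : Type u} [AddCommGroup V] [Module k V] (v : V) (a x y : A) :
    TensorProduct.assoc k V A (A ⊗[k] A) (TensorProduct.assoc k (V ⊗[k] A) A A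
      (hopfTwist (hopfTwist (TensorProduct.mk k V A) ∘ₗ comulTwo k).flip (comulTwo k a)
        ((v ⊗ₜ x) ⊗ₜ y))) = v ⊗ₜ doubleSandwich (x ⊗ₜ y) a := by
  have hd : (doubleSandwich (x ⊗ₜ y) : WithConv (A →ₗ[k] A ⊗[k] (A ⊗[k] A))) =
      toConv ((includeRight.comp includeRight : A →ₐ[k] A ⊗[k] (A ⊗[k] A)).toLinearMap ∘ₗ
        HopfAlgebra.antipode k) *
      ((convConst (1 ⊗ₜ (1 ⊗ₜ y)) *
        toConv ((Algebra.TensorProduct.map (AlgHom.id k A) includeLeft).toLinearMap ∘ₗ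
          sandwich.flip x ∘ₗ comulTwo k)) *
      toConv (includeRight.comp includeRight : A →ₐ[k] A ⊗[k] (A ⊗[k] A)).toLinearMap) := by
    have e1 : (Algebra.TensorProduct.map (AlgHom.id k A) (includeLeft : A →ₐ[k] A ⊗[k] A)).comp
        includeRight = includeRight.comp includeLeft := by
      ext a
      simp
    have e2 : (Algebra.TensorProduct.map (AlgHom.id k A) (includeLeft : A →ₐ[k] A ⊗[k] A)).comp
        includeLeft = includeLeft := by
      ext a
      simp [Algebra.TensorProduct.one_def]
    -- The nested form has `y` outside the inner antipode and `x` inside it. They are separated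
    -- here, and `1 ⊗ 1 ⊗ y` is then moved past the inner antipode, which lives in another tensor
    -- factor.
    have hz : (1 : A) ⊗ₜ[k] (x ⊗ₜ[k] y) = (1 ⊗ₜ (1 ⊗ₜ y)) *
        Algebra.TensorProduct.map (AlgHom.id k A) includeLeft (1 ⊗ₜ x) := by
      simp
    rw [algHom_comp_sandwich, e1, e2, doubleSandwich, hz, convConst_mul]
    simp only [← mul_assoc]
    congr 4
    rw [mul_assoc, mul_assoc, ← convConst_comm]
    intro a
    simp [Commute, SemiconjBy]
  rw [hd, conv_mul_mul_apply]
  generalize comulTwo k a = t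
  induction t with
  | zero => simp
  | add s t hs ht => simp only [map_add, LinearMap.add_apply, hs, ht, TensorProduct.tmul_add]
  | tmul a z =>
    induction z with
    | zero => simp
    | add s t hs ht => simp only [map_add, LinearMap.add_apply, hs, ht, TensorProduct.tmul_add]
    | tmul b c =>
      have h := convConst_mul_apply (k := k) ((1 : A) ⊗ₜ[k] ((1 : A) ⊗ₜ[k] y))
        (toConv ((Algebra.TensorProduct.map (AlgHom.id k A)
          (includeLeft : A →ₐ[k] A ⊗[k] A)).toLinearMap ∘ₗ
          sandwich.flip x ∘ₗ comulTwo k)) b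
      simp only [hopfTwist_tmul, TensorProduct.map_tmul, LinearMap.comp_apply,
        LinearMap.mul'_apply, LinearMap.flip_apply, hopfTwist_mk_tmul]
      erw [h]
      simp only [LinearMap.comp_apply, LinearMap.flip_apply]
      change _ = v ⊗ₜ ((1 ⊗ₜ (1 ⊗ₜ HopfAlgebra.antipode k a)) * (_ * Algebra.TensorProduct.map
          (AlgHom.id k A) includeLeft (sandwich (comulTwo k b) x) * (1 ⊗ₜ (1 ⊗ₜ c))))
      generalize sandwich (comulTwo k b) x = s
      induction s with
      | zero => simp
      | add s t hs ht =>
        simp only [map_add, mul_add, add_mul, TensorProduct.tmul_add, TensorProduct.add_tmul,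
          hs, ht]
      | tmul p q => simp [mul_assoc]

end Free

/-! ### The Yetter-Drinfeld axioms for `V ⊠ A`. -/

section FreeModule

variable {k A : Type u} [Field k] [Ring A] [HopfAlgebra k A]

theorem comulTwo_mul (a b : A) : comulTwo k (a * b) = comulTwo k a * comulTwo k b := by
  have h (s t : A ⊗[k] A) : (Coalgebra.comul (R := k) (A := A)).lTensor A (s * t) =
      (Coalgebra.comul (R := k) (A := A)).lTensor A s *
        (Coalgebra.comul (R := k) (A := A)).lTensor A t :=
    map_mul (Algebra.TensorProduct.map (AlgHom.id k A) (Bialgebra.comulAlgHom k A)) s t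
  simp only [comulTwo, LinearMap.comp_apply, Bialgebra.comul_mul, h]

theorem comulTwo_one : comulTwo k (1 : A) = 1 ⊗ₜ (1 ⊗ₜ 1) := by
  simp [comulTwo, Algebra.TensorProduct.one_def]

/-- Twisting by a product is twisting twice, because `S` is antimultiplicative. This gives the
compatibility axiom for `V ⊠ A`. -/
theorem hopfTwist_mul {V W W' : Type u} [AddCommGroup V] [Module k V] [AddCommGroup W]
    [Module k W] [AddCommGroup W'] [Module k W'] {f : V →ₗ[k] A →ₗ[k] W} {g : W →ₗ[k] A →ₗ[k] W'}
    {h : V →ₗ[k] A →ₗ[k] W'} (H : ∀ v a b, h v (a * b) = g (f v a) b)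
    (s t : A ⊗[k] (A ⊗[k] A)) (m : V ⊗[k] A) :
    hopfTwist h (s * t) m = hopfTwist g t (hopfTwist f s m) := by
  induction s with
  | zero => simp
  | add s s' hs hs' => simp only [map_add, LinearMap.add_apply, add_mul, hs, hs']
  | tmul a y =>
    induction y with
    | zero => simp
    | add s s' hs hs' =>
      simp only [map_add, LinearMap.add_apply, add_mul, TensorProduct.tmul_add, hs, hs']
    | tmul b c =>
      induction t with
      | zero => simp
      | add s s' hs hs' => simp only [map_add, LinearMap.add_apply, mul_add, hs, hs']
      | tmul a' y =>
        induction y with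
        | zero => simp
        | add s s' hs hs' =>
          simp only [map_add, LinearMap.add_apply, mul_add, TensorProduct.tmul_add, hs, hs']
        | tmul b' c' =>
          induction m with
          | zero => simp
          | add s s' hs hs' => simp only [map_add, hs, hs']
          | tmul v x => simp [H, HopfAlgebra.antipode_mul_antidistrib, mul_assoc]

theorem lTensor_counit_sandwich (a x : A) :
    (Coalgebra.counit (R := k) (A := A)).lTensor A (sandwich (comulTwo k a) x) =
      a ⊗ₜ Coalgebra.counit x := by
  have key (b : A) (t : A ⊗[k] A) :
      (Coalgebra.counit (R := k) (A := A)).lTensor A (sandwich (b ⊗ₜ t) x) =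
      Coalgebra.counit (R := k) x • Coalgebra.counit (R := k) b •
        (Coalgebra.counit (R := k) (A := A)).lTensor A t := by
    induction t with
    | zero => simp
    | add s t hs ht =>
      simp only [TensorProduct.tmul_add, map_add, LinearMap.add_apply, hs, ht, smul_add]
    | tmul c d =>
      simp only [sandwich_tmul, LinearMap.lTensor_tmul, Bialgebra.counit_mul,
        HopfAlgebra.counit_antipode, ← TensorProduct.tmul_smul, smul_eq_mul]
      congr 1
      ring
  have key2 (t : A ⊗[k] A) : (Coalgebra.counit (R := k) (A := A)).lTensor A
      (sandwich ((Coalgebra.comul (R := k) (A := A)).lTensor A t) x) =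
      Coalgebra.counit (R := k) x •
        (TensorProduct.lid k A (Coalgebra.counit.rTensor A t)) ⊗ₜ (1 : k) := by
    induction t with
    | zero => simp
    | add s t hs ht =>
      simp only [map_add, LinearMap.add_apply, hs, ht, TensorProduct.add_tmul, smul_add]
    | tmul b c =>
      rw [LinearMap.lTensor_tmul, key, Coalgebra.lTensor_counit_comul]
      simp [TensorProduct.smul_tmul']
  rw [comulTwo, LinearMap.comp_apply, key2, Coalgebra.rTensor_counit_comul]
  simp [TensorProduct.smul_tmul', TensorProduct.smul_tmul]

/-- The coaction `v ⊗ a ↦ v₍₀₎ ⊗ a₍₂₎ ⊗ S(a₍₁₎) v₍₁₎ a₍₃₎` of `V ⊠ A`. -/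
def freeCoact (V : RightComodule k A) : V.carrier ⊗[k] A →ₗ[k] (V.carrier ⊗[k] A) ⊗[k] A :=
  TensorProduct.lift
    ((hopfTwist (TensorProduct.mk k V.carrier A) ∘ₗ comulTwo k).flip ∘ₗ V.coact)

@[simp]
theorem freeCoact_tmul (V : RightComodule k A) (v : V.carrier) (a : A) :
    freeCoact V (v ⊗ₜ a) = hopfTwist (TensorProduct.mk k V.carrier A) (comulTwo k a) (V.coact v) :=
  rfl

/-- Coassociativity of `V ⊠ A` after that of `V` has been used: the double coaction of `V` appears
as `(id ⊗ Δ) m`, and `m` may be arbitrary. -/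
theorem assoc_hopfTwist_mk {V : Type u} [AddCommGroup V] [Module k V] (a : A) (m : V ⊗[k] A) :
    TensorProduct.assoc k (V ⊗[k] A) A A
      (hopfTwist (hopfTwist (TensorProduct.mk k V A) ∘ₗ comulTwo k).flip (comulTwo k a)
        ((TensorProduct.assoc k V A A).symm ((Coalgebra.comul (R := k)).lTensor V m))) =
    (Coalgebra.comul (R := k) (A := A)).lTensor (V ⊗[k] A)
      (hopfTwist (TensorProduct.mk k V A) (comulTwo k a) m) := by
  apply (TensorProduct.assoc k V A (A ⊗[k] A)).injective
  induction m with
  | zero => simp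
  | add s t hs ht => simp only [map_add, hs, ht]
  | tmul v x =>
    rw [hopfTwist_mk_tmul, LinearMap.lTensor_tmul]
    have h1 (z : A ⊗[k] A) : TensorProduct.assoc k V A (A ⊗[k] A)
        (TensorProduct.assoc k (V ⊗[k] A) A A
          (hopfTwist (hopfTwist (TensorProduct.mk k V A) ∘ₗ comulTwo k).flip (comulTwo k a)
            ((TensorProduct.assoc k V A A).symm (v ⊗ₜ z)))) = v ⊗ₜ doubleSandwich z a := by
      induction z with
      | zero => simp [doubleSandwich, convConst]
      | add s t hs ht =>
        rw [TensorProduct.tmul_add, map_add, map_add, map_add, map_add, hs, ht,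
          ← TensorProduct.tmul_add]
        congr 1
        have hc : (convConst (1 ⊗ₜ (s + t)) : WithConv (A →ₗ[k] A ⊗[k] (A ⊗[k] A))) =
            convConst (1 ⊗ₜ s) + convConst (1 ⊗ₜ t) := by
          ext a
          simp [convConst, TensorProduct.tmul_add]
        simp only [doubleSandwich, hc, mul_add, add_mul]
        rfl
      | tmul y z => exact hopfTwist_hopfTwist_mk v a y z
    have h2 (z : A ⊗[k] A) : TensorProduct.assoc k V A (A ⊗[k] A)
        ((Coalgebra.comul (R := k) (A := A)).lTensor (V ⊗[k] A)
          ((TensorProduct.assoc k V A A).symm (v ⊗ₜ z))) =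
        v ⊗ₜ (Coalgebra.comul (R := k) (A := A)).lTensor A z := by
      induction z with
      | zero => simp
      | add s t hs ht => simp only [map_add, TensorProduct.tmul_add, hs, ht]
      | tmul y z => simp
    rw [h1, h2, lTensor_comul_sandwich]

theorem freeCoact_assoc (V : RightComodule k A) (m : V.carrier ⊗[k] A) :
    TensorProduct.assoc k (V.carrier ⊗[k] A) A A ((freeCoact V).rTensor A (freeCoact V m)) =
      (Coalgebra.comul (R := k) (A := A)).lTensor (V.carrier ⊗[k] A) (freeCoact V m) := by
  induction m with
  | zero => simp
  | add s t hs ht => simp only [map_add, hs, ht]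
  | tmul v a =>
    rw [freeCoact_tmul, rTensor_hopfTwist _
      (hopfTwist (TensorProduct.mk k V.carrier A) ∘ₗ comulTwo k).flip V.coact _
      (fun _ _ => rfl), ← assoc_hopfTwist_mk, ← V.coact_assoc, LinearEquiv.symm_apply_apply]

theorem freeCoact_counit (V : RightComodule k A) (m : V.carrier ⊗[k] A) :
    (Coalgebra.counit (R := k) (A := A)).lTensor (V.carrier ⊗[k] A) (freeCoact V m) =
      m ⊗ₜ 1 := by
  have h (v : V.carrier) (z : A ⊗[k] A) : TensorProduct.assoc k V.carrier A k
      ((Coalgebra.counit (R := k) (A := A)).lTensor (V.carrier ⊗[k] A)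
        ((TensorProduct.assoc k V.carrier A A).symm (v ⊗ₜ z))) =
      v ⊗ₜ (Coalgebra.counit (R := k) (A := A)).lTensor A z := by
    induction z with
    | zero => simp
    | add s t hs ht => simp only [map_add, TensorProduct.tmul_add, hs, ht]
    | tmul y z => simp
  have h2 (a : A) (n : V.carrier ⊗[k] A) : (Coalgebra.counit (R := k) (A := A)).lTensor
      (V.carrier ⊗[k] A) (hopfTwist (TensorProduct.mk k V.carrier A) (comulTwo k a) n) =
      (TensorProduct.rightComm k V.carrier k A)
        (((Coalgebra.counit (R := k) (A := A)).lTensor V.carrier n) ⊗ₜ a) := by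
    induction n with
    | zero => simp
    | add s t hs ht => simp only [map_add, TensorProduct.add_tmul, hs, ht]
    | tmul v x =>
      apply (TensorProduct.assoc k V.carrier A k).injective
      rw [hopfTwist_mk_tmul, h, lTensor_counit_sandwich]
      simp
  induction m with
  | zero => simp
  | add s t hs ht => simp only [map_add, TensorProduct.add_tmul, hs, ht]
  | tmul v a =>
    rw [freeCoact_tmul, h2, V.coact_counit]
    simp

namespace YetterDrinfeld

/-- The free Yetter-Drinfeld module `V ⊠ A`. -/
def free (V : RightComodule k A) : YetterDrinfeld k A where
  carrier := V.carrier ⊗[k] A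
  coact := freeCoact V
  coact_assoc := freeCoact_assoc V
  coact_counit := freeCoact_counit V
  act := (LinearMap.lTensorHom V.carrier ∘ₗ (LinearMap.mul k A).flip).flip
  act_one m := by
    induction m with
    | zero => simp
    | add s t hs ht => simp only [map_add, LinearMap.add_apply, hs, ht]
    | tmul v a => simp
  act_mul m a b := by
    induction m with
    | zero => simp
    | add s t hs ht => simp only [map_add, LinearMap.add_apply, hs, ht]
    | tmul v a => simp [mul_assoc]
  coact_act m b := by
    induction m with
    | zero => simp
    | add s t hs ht => simp only [map_add, LinearMap.add_apply, hs, ht]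
    | tmul v a =>
      change freeCoact V (v ⊗ₜ (a * b)) = _
      rw [freeCoact_tmul, comulTwo_mul]
      exact hopfTwist_mul (fun _ _ _ => rfl) _ _ _

end YetterDrinfeld
end FreeModule

/-! ### Cosemisimplicity and projective Yetter-Drinfeld modules -/

section Cosemisimple

variable {k A : Type u} [Field k] [Ring A] [HopfAlgebra k A]
variable {B : Type u} [Ring B] [HopfAlgebra k B]

/-- The corestriction of a comodule along a map of coalgebras. -/
def RightComodule.corestrict (f : A →ₐc[k] B) (V : RightComodule k A) : RightComodule k B where
  carrier := V.carrier
  coact := (f : A →ₗ[k] B).lTensor V.carrier ∘ₗ V.coact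
  coact_assoc v := by
    rw [LinearMap.comp_apply, YetterDrinfeld.assoc_lTensor_coact, V.coact_assoc,
      YetterDrinfeld.comul_lTensor]
  coact_counit v := by
    rw [LinearMap.comp_apply, YetterDrinfeld.counit_lTensor, V.coact_counit]

theorem RightComodule.IsSubcomodule.corestrict (f : A →ₐc[k] B) {V : RightComodule k A}
    {W : Submodule k V.carrier} (hW : V.IsSubcomodule W) :
    (V.corestrict f).IsSubcomodule W := fun w hw => by
  obtain ⟨t, ht⟩ := hW w hw
  exact ⟨(f : A →ₗ[k] B).lTensor W t, (lTensor_rTensor_comm W.subtype (f : A →ₗ[k] B) t).symm.trans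
    (congrArg _ ht)⟩

/-- A Hopf algebra retract of a cosemisimple Hopf algebra is cosemisimple. -/
theorem IsCosemisimple.of_retract (ι : B →ₐc[k] A) (π : A →ₐc[k] B)
    (hπ : ∀ b, π (ι b) = b) (hA : IsCosemisimple k A) : IsCosemisimple k B := by
  intro V W hW
  obtain ⟨W', hW', hc⟩ := hA (V.corestrict ι) W (hW.corestrict ι)
  refine ⟨W', ?_, hc⟩
  have := hW'.corestrict π
  intro w hw
  obtain ⟨t, ht⟩ := this w hw
  refine ⟨t, ht.trans ?_⟩
  change (π : A →ₗ[k] B).lTensor V.carrier ((ι : B →ₗ[k] A).lTensor V.carrier (V.coact w)) = _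
  -- Corestriction along `ι` and then `π` returns the original coaction, so a complement over `A` is
  -- one over `B`.
  have h : (π : A →ₗ[k] B) ∘ₗ (ι : B →ₗ[k] A) = LinearMap.id := LinearMap.ext hπ
  rw [← LinearMap.lTensor_comp_apply, h, LinearMap.lTensor_id]
  rfl

namespace YetterDrinfeld

/-- Over a cosemisimple Hopf algebra, epimorphisms split colinearly. -/
theorem exists_colinear_section (hA : IsCosemisimple k A) {X Y : YetterDrinfeld k A} (e : X ⟶ Y)
    (he : Function.Surjective e.lin) : ∃ s : Y.carrier →ₗ[k] X.carrier,
      e.lin ∘ₗ s = LinearMap.id ∧ ∀ y, s.rTensor A (Y.coact y) = X.coact (s y) := by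
  obtain ⟨W, hW, hc⟩ := hA X.toRightComodule _ (ker_coact e)
  have hinj : Function.Injective (e.lin ∘ₗ W.subtype) := by
    rw [← LinearMap.ker_eq_bot, LinearMap.ker_eq_bot']
    intro w hw
    exact Subtype.ext (Submodule.disjoint_def.1 hc.disjoint w.1 hw w.2)
  have hsurj : Function.Surjective (e.lin ∘ₗ W.subtype) := fun y => by
    obtain ⟨x, rfl⟩ := he y
    obtain ⟨u, hu, w, hw, rfl⟩ := Submodule.mem_sup.1 (hc.sup_eq_top ▸ Submodule.mem_top (x := x))
    exact ⟨⟨w, hw⟩, by simp [LinearMap.mem_ker.1 hu]⟩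
  let E := LinearEquiv.ofBijective (e.lin ∘ₗ W.subtype) ⟨hinj, hsurj⟩
  refine ⟨W.subtype ∘ₗ E.symm.toLinearMap, LinearMap.ext fun y => E.apply_symm_apply y,
    fun y => ?_⟩
  obtain ⟨w, rfl⟩ := E.surjective y
  obtain ⟨t, ht⟩ := hW w.1 w.2
  have h1 : Y.coact (E w) = E.toLinearMap.rTensor A t := by
    change Y.coact (e.lin w.1) = _
    rw [← e.map_coact, ← ht, ← LinearMap.rTensor_comp_apply]
    rfl
  have h2 : (W.subtype ∘ₗ E.symm.toLinearMap) ∘ₗ E.toLinearMap = W.subtype := by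
    ext w
    simp
  rw [h1, ← LinearMap.rTensor_comp_apply, h2]
  simpa using ht

/-- The unit `v ↦ v ⊗ 1` of the free-forgetful adjunction is colinear. -/
theorem coact_one {X : YetterDrinfeld k A} {V : RightComodule k A}
    {e : V.carrier ⊗[k] A ≃ₗ[k] X.carrier}
    (hc : ∀ v a, X.coact (e (v ⊗ₜ a)) = e.toLinearMap.rTensor A
      (hopfTwist (TensorProduct.mk k V.carrier A) (comulTwo k a) (V.coact v))) (v : V.carrier) :
    (e.toLinearMap ∘ₗ (TensorProduct.mk k V.carrier A).flip 1).rTensor A (V.coact v) =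
      X.coact (e (v ⊗ₜ 1)) := by
  rw [hc, comulTwo_one, LinearMap.rTensor_comp_apply]
  congr 1
  generalize V.coact v = m
  induction m with
  | zero => simp
  | add s t hs ht => simp only [map_add, hs, ht]
  | tmul v x => simp

/-- A colinear map `V → X` extends to a morphism from the free module on `V`. -/
theorem exists_extension {X P : YetterDrinfeld k A} {V : RightComodule k A}
    {E : V.carrier ⊗[k] A ≃ₗ[k] P.carrier}
    (ha : ∀ v a b, P.act (E (v ⊗ₜ a)) b = E (v ⊗ₜ (a * b)))
    (hc : ∀ v a, P.coact (E (v ⊗ₜ a)) = E.toLinearMap.rTensor A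
      (hopfTwist (TensorProduct.mk k V.carrier A) (comulTwo k a) (V.coact v)))
    {j : V.carrier →ₗ[k] X.carrier} (hj : ∀ v, j.rTensor A (V.coact v) = X.coact (j v)) :
    ∃ g : P ⟶ X, ∀ v a, g.lin (E (v ⊗ₜ a)) = X.act (j v) a := by
  let g : P.carrier →ₗ[k] X.carrier := TensorProduct.lift (X.act ∘ₗ j) ∘ₗ E.symm.toLinearMap
  have hg (v a) : g (E (v ⊗ₜ a)) = X.act (j v) a := by simp [g]
  have ind {M : Type u} [AddCommGroup M] [Module k M] {u w : P.carrier →ₗ[k] M}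
      (h : ∀ v a, u (E (v ⊗ₜ a)) = w (E (v ⊗ₜ a))) : u = w := by
    have : u ∘ₗ E.toLinearMap = w ∘ₗ E.toLinearMap := TensorProduct.ext' h
    ext p
    obtain ⟨m, rfl⟩ := E.surjective p
    exact LinearMap.congr_fun this m
  refine ⟨⟨g, fun p b => ?_, fun p => ?_⟩, hg⟩
  · have : g ∘ₗ P.act.flip b = X.act.flip b ∘ₗ g := ind fun v a => by
      simp only [LinearMap.comp_apply, LinearMap.flip_apply, ha, hg, X.act_mul]
    exact LinearMap.congr_fun this p
  -- The compatibility axiom of `X` computes its coaction on `j v ← a` by the same twist that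
  -- defines the coaction of the free module.
  · have : g.rTensor A ∘ₗ P.coact = X.coact ∘ₗ g := ind fun v a => by
      simp only [LinearMap.comp_apply, hc, hg, X.coact_act, ← hj]
      rw [← LinearMap.rTensor_comp_apply]
      exact rTensor_hopfTwist _ _ _ _ hg _ _
    exact LinearMap.congr_fun this p

/-- Free Yetter-Drinfeld modules over a cosemisimple Hopf algebra are projective. -/
theorem IsFree.projective (hA : IsCosemisimple k A) {P : YetterDrinfeld k A} (hP : P.IsFree) :
    Projective P where
  factors {X Y} f e _ := by
    obtain ⟨V, E, hact, hco⟩ := hP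
    obtain ⟨s, hs, hsco⟩ := exists_colinear_section hA e (surjective_of_epi e)
    let i : V.carrier →ₗ[k] P.carrier := E.toLinearMap ∘ₗ (TensorProduct.mk k V.carrier A).flip 1
    have hi (v) : i.rTensor A (V.coact v) = P.coact (i v) := coact_one hco v
    -- The section `s` is only colinear, so only the generators `V` are lifted through it; the
    -- action determines the rest.
    obtain ⟨g, hg⟩ := exists_extension hact hco (j := s ∘ₗ f.lin ∘ₗ i) (fun v => by
      rw [LinearMap.rTensor_comp_apply, LinearMap.rTensor_comp_apply, hi, f.map_coact, hsco]
      rfl)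
    refine ⟨g, hom_ext fun p => ?_⟩
    obtain ⟨m, rfl⟩ := E.surjective p
    induction m with
    | zero => simp
    | add s t hs ht => simp only [map_add, hs, ht]
    | tmul v a =>
      have h1 : f.lin (E (v ⊗ₜ a)) = Y.act (f.lin (i v)) a := by
        rw [← f.map_act]
        simp [i, hact]
      rw [comp_lin, LinearMap.comp_apply, hg, e.map_act, h1]
      exact congrArg (fun z => Y.act z a) (LinearMap.congr_fun hs (f.lin (i v)))

theorem free_coact_refl (V : RightComodule k A) (v : V.carrier) (a : A) :
    (free V).coact (v ⊗ₜ[k] a) =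
      (LinearEquiv.refl k (V.carrier ⊗[k] A)).toLinearMap.rTensor A
        (hopfTwist (TensorProduct.mk k V.carrier A) (comulTwo k a) (V.coact v)) := by
  have h (t : (V.carrier ⊗[k] A) ⊗[k] A) :
      (LinearEquiv.refl k (V.carrier ⊗[k] A)).toLinearMap.rTensor A t = t := by simp
  exact (h _).symm

theorem isFree_free (V : RightComodule k A) : (free V).IsFree :=
  ⟨V, LinearEquiv.refl k _, fun _ _ _ => rfl, free_coact_refl V⟩

/-- Every Yetter-Drinfeld module is a quotient of a free one. -/
theorem exists_free_epi (X : YetterDrinfeld k A) :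
    ∃ (P : YetterDrinfeld k A) (p : P ⟶ X), P.IsFree ∧ Function.Surjective p.lin := by
  -- The counit `X ⊠ A → X`, `x ⊗ a ↦ x ← a`.
  obtain ⟨g, hg⟩ := exists_extension (X := X) (P := free X.toRightComodule)
    (V := X.toRightComodule) (E := LinearEquiv.refl k _) (j := LinearMap.id)
    (fun _ _ _ => rfl) (free_coact_refl _) (by simp)
  exact ⟨_, g, isFree_free _, fun x => ⟨x ⊗ₜ 1, (hg x 1).trans (X.act_one x)⟩⟩

/-- A Yetter-Drinfeld module which is isomorphic to `U ⊠ A` as a module, by a map whose restriction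
to `U` is colinear, is free. -/
theorem isFree_of_colinear {Y : YetterDrinfeld k A} (U : RightComodule k A)
    (g : U.carrier →ₗ[k] Y.carrier) (hg : ∀ u, g.rTensor A (U.coact u) = Y.coact (g u))
    (e : U.carrier ⊗[k] A ≃ₗ[k] Y.carrier) (he : ∀ u a, e (u ⊗ₜ a) = Y.act (g u) a) :
    Y.IsFree := by
  refine ⟨U, e, fun u a b => ?_, fun u a => ?_⟩
  · rw [he, he, Y.act_mul]
  -- The compatibility axiom in `Y` leaves no choice for the coaction on `g u ← a`.
  · rw [he, Y.coact_act, ← hg]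
    exact (rTensor_hopfTwist _ _ _ _ he _ _).symm

/-! #### Projective dimension -/

theorem shortExact_of_ker_eq_range {S : ShortComplex (YetterDrinfeld k A)}
    (hf : Function.Injective S.f.lin) (hg : Function.Surjective S.g.lin)
    (h : LinearMap.ker S.g.lin ≤ LinearMap.range S.f.lin) : S.ShortExact :=
  haveI := mono_of_injective hf
  haveI := epi_of_surjective hg
  { exact := S.exact_of_f_is_kernel (isKernel S.zero hf h) }

/-- If it sends free modules to free modules, the functor induced by a projection of a cosemisimple
Hopf algebra does not increase projective dimensions. -/
theorem hasProjectiveDimensionLT_inducedObj (ι : B →ₐc[k] A) (π : A →ₐc[k] B)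
    (hπ : ∀ b, π (ι b) = b) (hA : IsCosemisimple k A)
    (hF : ∀ X : YetterDrinfeld k A, X.IsFree → ((inducedFunctor ι π hπ).obj X).IsFree) (n : ℕ)
    (X : YetterDrinfeld k A) (hX : HasProjectiveDimensionLT X n) :
    HasProjectiveDimensionLT ((inducedFunctor ι π hπ).obj X) n := by
  have hB := hA.of_retract ι π hπ
  induction n generalizing X with
  | zero =>
    rw [hasProjectiveDimensionLT_zero_iff_isZero, IsZero.iff_id_eq_zero] at hX ⊢
    exact hom_ext fun v => congr(($hX).lin v)
  | succ n ih =>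
    obtain ⟨P, p, hP, hp⟩ := exists_free_epi X
    -- Dimension shifting relates the bound `n + 2` for `X` to `n + 1` for its syzygy; the bound
    -- `1`, where `X` is projective and hence a retract of `P`, needs a separate argument.
    cases n with
    | zero =>
      rw [zero_add] at hX ⊢
      have := projective_iff_hasProjectiveDimensionLT_one.2 hX
      have := epi_of_surjective hp
      have r : Retract X P := ⟨Projective.factorThru (𝟙 X) p, p, Projective.factorThru_comp _ _⟩
      have := (hF P hP).projective hB
      exact (r.map (inducedFunctor ι π hπ)).hasProjectiveDimensionLT 1
    | succ n =>
      let S : ShortComplex (YetterDrinfeld k A) := .mk _ p (subIncl_comp p)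
      have hS : S.ShortExact := shortExact_of_ker_eq_range Subtype.val_injective hp
        (Submodule.range_subtype _).ge
      let S' : ShortComplex (YetterDrinfeld k B) :=
        .mk ((inducedFunctor ι π hπ).map S.f) ((inducedFunctor ι π hπ).map S.g)
          (hom_ext fun v => congr(($(S.zero)).lin v))
      -- Exactness is a condition on underlying linear maps, which the functor does not change.
      have hS' : S'.ShortExact := shortExact_of_ker_eq_range Subtype.val_injective hp
        (Submodule.range_subtype _).ge
      have h2 := (hF P hP).projective hB
      exact (hS'.hasProjectiveDimensionLT_X₃_iff n h2).2
        (ih _ ((hS.hasProjectiveDimensionLT_X₃_iff n (hP.projective hA)).1 hX))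

/-- The induced functor sends the trivial module to the trivial module. -/
def inducedTrivialIso (ι : B →ₐc[k] A) (π : A →ₐc[k] B) (hπ : ∀ b, π (ι b) = b) :
    (inducedFunctor ι π hπ).obj (trivial k A) ≅ trivial k B :=
  have hact (v : k) (b : B) : v * Coalgebra.counit (R := k) (ι b) =
      v * Coalgebra.counit (R := k) b := by rw [CoalgHomClass.counit_comp_apply]
  have hco (v : k) : (π : A →ₗ[k] B).lTensor k (v ⊗ₜ[k] (1 : A)) = v ⊗ₜ 1 := by simp
  have hid (t : k ⊗[k] B) : (LinearMap.id (M := k)).rTensor B t = t := by simp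
  { hom :=
    { lin := LinearMap.id (M := k)
      map_act := hact
      map_coact := fun v =>
        (hid _).trans (hco v) }
    inv :=
    { lin := LinearMap.id (M := k)
      map_act := fun v b => (hact v b).symm
      map_coact := fun v =>
        (hid _).trans (hco v).symm }
    hom_inv_id := rfl
    inv_hom_id := rfl }

/-- A nonzero `Extⁱ(k, V)` with `i ≥ n` would make the supremum at least `n`. -/
theorem hasProjectiveDimensionLT_of_gsDim_lt {n : ℕ} (h : gsDim k A < n) :
    HasProjectiveDimensionLT (trivial k A) n where
  subsingleton' i hi V := by
    rw [← not_nontrivial_iff_subsingleton]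
    intro hV
    have h1 : (i : ℕ∞) ≤ gsDim k A := le_sSup ⟨i, rfl, V, hV⟩
    exact absurd (h1.trans_lt h) (not_lt.2 (by exact_mod_cast hi))

theorem gsDim_le_of_isFree_inducedFunctor (ι : B →ₐc[k] A) (π : A →ₐc[k] B)
    (hπ : ∀ b, π (ι b) = b) (hA : IsCosemisimple k A)
    (hF : ∀ X : YetterDrinfeld k A, X.IsFree → ((inducedFunctor ι π hπ).obj X).IsFree) :
    gsDim k B ≤ gsDim k A := by
  refine sSup_le ?_
  rintro _ ⟨n, rfl, V, hV⟩
  by_contra! h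
  have h1 := hasProjectiveDimensionLT_inducedObj ι π hπ hA hF n _
    (hasProjectiveDimensionLT_of_gsDim_lt h)
  have h2 := hasProjectiveDimensionLT_of_iso (inducedTrivialIso ι π hπ) n
  exact not_subsingleton_iff_nontrivial.2 hV (h2.subsingleton' n le_rfl (Y := V))

end YetterDrinfeld
end Cosemisimple

/-! ### Free modules over a Hopf algebra with a projection -/

section Projection

open WithConv Algebra.TensorProduct

variable {k A B : Type u} [Field k] [Ring A] [HopfAlgebra k A] [Ring B] [HopfAlgebra k B]
variable (ι : B →ₐc[k] A) (π : A →ₐc[k] B)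

/-- The right coaction `a ↦ a₍₁₎ ⊗ π(a₍₂₎)` of `B` on `A`. -/
def projCoact : A →ₐ[k] A ⊗[k] B :=
  (Algebra.TensorProduct.map (AlgHom.id k A) (π : A →ₐ[k] B)).comp (Bialgebra.comulAlgHom k A)

theorem projCoact_apply (a : A) :
    projCoact π a = (π : A →ₗ[k] B).lTensor A (Coalgebra.comul a) := rfl

theorem projCoact_conv : toConv (projCoact π).toLinearMap =
    toConv (includeLeft : A →ₐ[k] A ⊗[k] B).toLinearMap *
      toConv ((includeRight : B →ₐ[k] A ⊗[k] B).comp (π : A →ₐ[k] B)).toLinearMap :=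
  (conv_includeLeft_mul_includeRight LinearMap.id (π : A →ₗ[k] B)).symm

/-- The coinvariants `a₍₁₎ ⊗ π(a₍₂₎) = a ⊗ 1`. -/
def coinvariants : Submodule k A :=
  LinearMap.eqLocus (projCoact π).toLinearMap (includeLeft : A →ₐ[k] A ⊗[k] B).toLinearMap

theorem mem_coinvariants {a : A} : a ∈ coinvariants π ↔ projCoact π a = a ⊗ₜ 1 := Iff.rfl

/-- Presents the coinvariants as a kernel, so that flatness over `k` identifies `A ⊗ R` with a
kernel in `A ⊗ A`. -/
theorem exact_coinvariants : Function.Exact (coinvariants π).subtype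
    ((projCoact π).toLinearMap - (includeLeft : A →ₐ[k] A ⊗[k] B).toLinearMap) := fun a => by
  simp [mem_coinvariants, sub_eq_zero]

/-- The projection `a ↦ a₍₁₎ ι S(π(a₍₂₎))` onto the coinvariants. -/
def coinvProj : A →ₗ[k] A :=
  TensorProduct.lift ((LinearMap.mul k A).compl₂
    ((ι : B →ₗ[k] A) ∘ₗ HopfAlgebra.antipode k)) ∘ₗ (projCoact π).toLinearMap

theorem coinvProj_conv : toConv (coinvProj ι π) = toConv (LinearMap.id (R := k) (M := A)) *
    toConv (((ι : B →ₐ[k] A).comp (π : A →ₐ[k] B)).toLinearMap ∘ₗ HopfAlgebra.antipode k) := by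
  ext a
  change TensorProduct.lift _ ((π : A →ₗ[k] B).lTensor A (Coalgebra.comul a)) =
    LinearMap.mul' k A (TensorProduct.map _ _ (Coalgebra.comul a))
  generalize (Coalgebra.comul a : A ⊗[k] A) = t
  induction t with
  | zero => simp
  | add s t hs ht => simp only [map_add, hs, ht]
  | tmul a b => simp [map_antipode]

/-- Write `θ = ι ∘ π`, `ρ` for the coaction `projCoact π`, and `P = id * θS` for the projection.
Then `ρ = iL * iR` and `ρθ = iL θ * iR`, so `ρ ∘ P = ρ * (ρθ)S = iL * iR * iR S * iL θS`. The middle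
factors cancel and leave `iL ∘ P`. -/
theorem coinvProj_mem (hπ : ∀ b, π (ι b) = b) (a : A) : coinvProj ι π a ∈ coinvariants π := by
  let θ : A →ₐ[k] A := (ι : B →ₐ[k] A).comp (π : A →ₐ[k] B)
  let iL : A →ₐ[k] A ⊗[k] B := includeLeft
  let iR : A →ₐ[k] A ⊗[k] B := (includeRight : B →ₐ[k] A ⊗[k] B).comp (π : A →ₐ[k] B)
  have hρ : toConv (projCoact π).toLinearMap = toConv iL.toLinearMap * toConv iR.toLinearMap :=
    projCoact_conv π
  have hρθ : toConv ((projCoact π).comp θ).toLinearMap =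
      toConv (iL.comp θ).toLinearMap * toConv iR.toLinearMap := by
    refine Eq.trans ?_ (conv_includeLeft_mul_includeRight θ.toLinearMap (π : A →ₗ[k] B)).symm
    ext a
    change (π : A →ₗ[k] B).lTensor A (Coalgebra.comul (ι (π a))) =
      TensorProduct.map _ _ (Coalgebra.comul a)
    rw [← CoalgHomClass.map_comp_comul_apply, ← CoalgHomClass.map_comp_comul_apply]
    generalize (Coalgebra.comul a : A ⊗[k] A) = t
    induction t with
    | zero => simp
    | add s t hs ht => simp only [map_add, hs, ht]
    | tmul a b => simp [hπ, θ]
  have hinv : toConv (((projCoact π).comp θ).toLinearMap ∘ₗ HopfAlgebra.antipode k) =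
      toConv (iR.toLinearMap ∘ₗ HopfAlgebra.antipode k) *
        toConv ((iL.comp θ).toLinearMap ∘ₗ HopfAlgebra.antipode k) := by
    refine left_inv_eq_right_inv (conv_antipode_mul_algHom _) ?_
    rw [hρθ, mul_assoc, ← mul_assoc (toConv iR.toLinearMap), conv_algHom_mul_antipode, one_mul,
      conv_algHom_mul_antipode]
  have h : toConv ((projCoact π).toLinearMap ∘ₗ coinvProj ι π) =
      toConv (iL.toLinearMap ∘ₗ coinvProj ι π) := by
    have hP := congrArg ofConv (coinvProj_conv ι π)
    have e1 := congrArg toConv ((congrArg (LinearMap.comp (projCoact π).toLinearMap) hP).trans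
      (LinearMap.algHom_comp_convMul_distrib _ _ _))
    have e2 := congrArg toConv ((congrArg (LinearMap.comp iL.toLinearMap) hP).trans
      (LinearMap.algHom_comp_convMul_distrib _ _ _))
    refine e1.trans (Eq.trans ?_ e2.symm)
    change toConv (projCoact π).toLinearMap *
      toConv (((projCoact π).comp θ).toLinearMap ∘ₗ HopfAlgebra.antipode k) =
      toConv iL.toLinearMap * toConv ((iL.comp θ).toLinearMap ∘ₗ HopfAlgebra.antipode k)
    rw [hinv, hρ, mul_assoc, ← mul_assoc (toConv iR.toLinearMap), conv_algHom_mul_antipode,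
      one_mul]
  exact LinearMap.congr_fun (toConv_injective h) a

theorem projCoact_ι (hπ : ∀ b, π (ι b) = b) (b : B) :
    projCoact π (ι b) = (ι : B →ₗ[k] A).rTensor B (Coalgebra.comul b) := by
  rw [projCoact_apply, ← CoalgHomClass.map_comp_comul_apply]
  generalize (Coalgebra.comul b : B ⊗[k] B) = t
  induction t with
  | zero => simp
  | add s t hs ht => simp only [map_add, hs, ht]
  | tmul a b => simp [hπ]

/-- Since `ρ(r ι(b)) = r ι(b₍₁₎) ⊗ b₍₂₎`, the projection yields `r ι(b₍₁₎ S(b₍₂₎))`. -/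
theorem coinvProj_mul (hπ : ∀ b, π (ι b) = b) {r : A} (hr : r ∈ coinvariants π) (b : B) :
    coinvProj ι π (r * ι b) = Coalgebra.counit (R := k) b • r := by
  have h (t : B ⊗[k] B) : TensorProduct.lift ((LinearMap.mul k A).compl₂
      ((ι : B →ₗ[k] A) ∘ₗ HopfAlgebra.antipode k))
        ((r ⊗ₜ 1) * (ι : B →ₗ[k] A).rTensor B t) =
      r * ι (LinearMap.mul' k B ((HopfAlgebra.antipode k).lTensor B t)) := by
    induction t with
    | zero => simp
    | add s t hs ht => simp only [map_add, mul_add, hs, ht]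
    | tmul a b => simp [mul_assoc]
  change TensorProduct.lift _ (projCoact π (r * ι b)) = _
  rw [map_mul, (mem_coinvariants π).1 hr, projCoact_ι ι π hπ, h,
    HopfAlgebra.mul_antipode_lTensor_comul_apply, AlgHomClass.commutes,
    Algebra.algebraMap_eq_smul_one, mul_smul_comm, mul_one]

/-- The multiplication map `R ⊗ B → A`, where `R` is the space of coinvariants. -/
def coinvMul : coinvariants π ⊗[k] B →ₗ[k] A :=
  TensorProduct.lift ((LinearMap.mul k A).compl₁₂ (coinvariants π).subtype (ι : B →ₗ[k] A))

@[simp]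
theorem coinvMul_tmul (r : coinvariants π) (b : B) : coinvMul ι π (r ⊗ₜ b) = r * ι b := rfl

/-- If the bialgebra map `π : A → B` is a retraction of `ι : B → A`, then `A` is the
tensor product of the coinvariants and `B`. -/
def coinvEquiv (hπ : ∀ b, π (ι b) = b) : coinvariants π ⊗[k] B ≃ₗ[k] A :=
  let P : A →ₗ[k] coinvariants π := (coinvProj ι π).codRestrict _ (coinvProj_mem ι π hπ)
  -- The inverse is `a ↦ P(a₍₁₎) ⊗ π(a₍₂₎)`. With `θ = ι ∘ π`, one composite is `P * θ = id * θS * θ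
  -- = id`; the other is `r ⊗ b ↦ P(r ι(b₍₁₎)) ⊗ b₍₂₎ = r ⊗ b`.
  LinearEquiv.ofLinearMap (coinvMul ι π) (P.rTensor B ∘ₗ (projCoact π).toLinearMap)
    (by
      have h : toConv (coinvProj ι π) *
          toConv ((ι : B →ₐ[k] A).comp (π : A →ₐ[k] B)).toLinearMap = toConv LinearMap.id := by
        rw [coinvProj_conv, mul_assoc, conv_antipode_mul_algHom, mul_one]
      refine Eq.trans ?_ (congrArg ofConv h)
      ext a
      change coinvMul ι π (P.rTensor B ((π : A →ₗ[k] B).lTensor A (Coalgebra.comul a))) =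
        LinearMap.mul' k A (TensorProduct.map _ _ (Coalgebra.comul a))
      generalize (Coalgebra.comul a : A ⊗[k] A) = t
      induction t with
      | zero => simp
      | add s t hs ht => simp only [map_add, hs, ht]
      | tmul a b => simp [P])
    (TensorProduct.ext' fun r b => by
      have h (t : B ⊗[k] B) : P.rTensor B ((r.1 ⊗ₜ 1) * (ι : B →ₗ[k] A).rTensor B t) =
          r ⊗ₜ TensorProduct.lid k B (Coalgebra.counit.rTensor B t) := by
        induction t with
        | zero => simp
        | add s t hs ht => simp only [map_add, mul_add, hs, ht, TensorProduct.tmul_add]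
        | tmul a b =>
          have hP : P (r * ι a) = Coalgebra.counit (R := k) a • r :=
            Subtype.ext (coinvProj_mul ι π hπ r.2 a)
          simp [hP, TensorProduct.smul_tmul]
      change P.rTensor B (projCoact π (r * ι b)) = r ⊗ₜ b
      rw [map_mul, (mem_coinvariants π).1 r.2, projCoact_ι ι π hπ, h,
        Coalgebra.rTensor_counit_comul]
      simp)

theorem coinvEquiv_tmul (hπ : ∀ b, π (ι b) = b) (r : coinvariants π) (b : B) :
    coinvEquiv ι π hπ (r ⊗ₜ b) = r * ι b := rfl

/-- The comultiplication of a coinvariant has coinvariant second leg. -/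
theorem lTensor_projCoact_comul {r : A} (hr : r ∈ coinvariants π) :
    (projCoact π).toLinearMap.lTensor A (Coalgebra.comul r) =
      (includeLeft : A →ₐ[k] A ⊗[k] B).toLinearMap.lTensor A (Coalgebra.comul r) := by
  have h1 (t : A ⊗[k] A) : (projCoact π).toLinearMap.lTensor A t =
      ((π : A →ₗ[k] B).lTensor A).lTensor A ((Coalgebra.comul (R := k)).lTensor A t) := by
    rw [← LinearMap.lTensor_comp_apply]
    rfl
  have h2 (t : A ⊗[k] A) : ((π : A →ₗ[k] B).lTensor A).lTensor A
      (TensorProduct.assoc k A A A ((Coalgebra.comul (R := k)).rTensor A t)) =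
      TensorProduct.assoc k A A B ((Coalgebra.comul (R := k)).rTensor B
        ((π : A →ₗ[k] B).lTensor A t)) := by
    induction t with
    | zero => simp
    | add s t hs ht => simp only [map_add, hs, ht]
    | tmul a b =>
      simp only [LinearMap.rTensor_tmul, LinearMap.lTensor_tmul]
      generalize (Coalgebra.comul a : A ⊗[k] A) = t
      induction t with
      | zero => simp
      | add s t hs ht => simp only [TensorProduct.add_tmul, map_add, hs, ht]
      | tmul a b => simp
  have h3 (t : A ⊗[k] A) : TensorProduct.assoc k A A B (t ⊗ₜ 1) =
      (includeLeft : A →ₐ[k] A ⊗[k] B).toLinearMap.lTensor A t := by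
    induction t with
    | zero => simp
    | add s t hs ht => simp only [TensorProduct.add_tmul, map_add, hs, ht]
    | tmul a b => simp
  rw [h1, ← Coalgebra.coassoc_apply, h2, ← projCoact_apply, (mem_coinvariants π).1 hr,
    LinearMap.rTensor_tmul, h3]

theorem comul_mem_coinvariants {r : A} (hr : r ∈ coinvariants π) :
    Coalgebra.comul r ∈ LinearMap.range ((coinvariants π).subtype.lTensor A) := by
  refine (Module.Flat.lTensor_exact A (exact_coinvariants π) _).1 ?_
  rw [LinearMap.lTensor_sub, LinearMap.sub_apply, lTensor_projCoact_comul π hr, sub_self]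

/-- On coinvariants, the coaction of the module induced from `V ⊠ A` takes values in
coinvariants. -/
theorem lTensor_sandwich_mem {r : A} (hr : r ∈ coinvariants π) (x : A) :
    (π : A →ₗ[k] B).lTensor A (sandwich (comulTwo k r) x) ∈
      LinearMap.range ((coinvariants π).subtype.rTensor B) := by
  -- `H` sends `a ⊗ (b ⊗ c)` to `b ⊗ π(S(a)) π(x) c`; when it is applied to `r₍₁₎ ⊗ r₍₂₎ ⊗ π(r₍₃₎)`,
  -- coinvariance replaces the last leg by `1`.
  let H : A ⊗[k] (A ⊗[k] B) →ₗ[k] A ⊗[k] B := TensorProduct.lift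
    (LinearMap.lTensorHom A ∘ₗ LinearMap.mul k B ∘ₗ LinearMap.mulRight k (π x) ∘ₗ
      (π : A →ₗ[k] B) ∘ₗ HopfAlgebra.antipode k)
  have h1 (t : A ⊗[k] A) : (π : A →ₗ[k] B).lTensor A
      (sandwich ((Coalgebra.comul (R := k)).lTensor A t) x) =
        H ((projCoact π).toLinearMap.lTensor A t) := by
    induction t with
    | zero => simp
    | add s t hs ht => simp only [map_add, LinearMap.add_apply, hs, ht]
    | tmul a b =>
      change (π : A →ₗ[k] B).lTensor A (sandwich (a ⊗ₜ Coalgebra.comul b) x) =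
        H (a ⊗ₜ (π : A →ₗ[k] B).lTensor A (Coalgebra.comul b))
      generalize (Coalgebra.comul b : A ⊗[k] A) = t
      induction t with
      | zero => simp
      | add s t hs ht =>
        simp only [map_add, LinearMap.add_apply, TensorProduct.tmul_add, hs, ht]
      | tmul b c => simp [H]
  rw [comulTwo, LinearMap.comp_apply, h1, lTensor_projCoact_comul π hr]
  obtain ⟨t, ht⟩ := comul_mem_coinvariants π hr
  rw [← ht]
  clear ht
  induction t with
  | zero => simp
  | add s t hs ht => simpa only [map_add] using add_mem hs ht
  | tmul a s => exact ⟨s ⊗ₜ (π (HopfAlgebra.antipode k a) * π x), by simp [H]⟩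

/-- The comodule structure on `U` induced by an injection `i : U → Y` into a comodule whose range
is a subcomodule. -/
def RightComodule.restrict (Y : RightComodule k B) {U : Type u} [AddCommGroup U] [Module k U]
    (i : U →ₗ[k] Y.carrier) (hi : Function.Injective i)
    (h : ∀ u, Y.coact (i u) ∈ LinearMap.range (i.rTensor B)) : RightComodule k B :=
  have inj (P : Type u) [AddCommGroup P] [Module k P] : Function.Injective (i.rTensor P) :=
    Module.Flat.rTensor_preserves_injective_linearMap _ hi
  let e := LinearEquiv.ofInjective (i.rTensor B) (inj B)
  let c : U →ₗ[k] U ⊗[k] B := e.symm.toLinearMap ∘ₗ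
    (Y.coact ∘ₗ i).codRestrict (LinearMap.range (i.rTensor B)) h
  have hc (u : U) : i.rTensor B (c u) = Y.coact (i u) := by
    change (e (e.symm _)).1 = _
    rw [e.apply_symm_apply]
    rfl
  { carrier := U
    coact := c
    coact_assoc := fun u => inj _ (by
      rw [← assoc_rTensor_coact _ hc, ← lTensor_rTensor_comm, hc, Y.coact_assoc])
    coact_counit := fun u => inj _ (by
      rw [← lTensor_rTensor_comm, hc, Y.coact_counit, LinearMap.rTensor_tmul]) }

theorem RightComodule.rTensor_coact_restrict (Y : RightComodule k B) {U : Type u} [AddCommGroup U]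
    [Module k U] (i : U →ₗ[k] Y.carrier) (hi : Function.Injective i)
    (h : ∀ u, Y.coact (i u) ∈ LinearMap.range (i.rTensor B)) (u : U) :
    i.rTensor B ((Y.restrict i hi h).coact u) = Y.coact (i u) := by
  let e := LinearEquiv.ofInjective (i.rTensor B)
    (Module.Flat.rTensor_preserves_injective_linearMap _ hi)
  change (e (e.symm _)).1 = _
  rw [e.apply_symm_apply]
  rfl

/-- This makes `V ⊗ R` a `B`-subcomodule of the module induced from `V ⊠ A`. -/
theorem lTensor_hopfTwist_mk_mem {V : Type u} [AddCommGroup V] [Module k V] {r : A}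
    (hr : r ∈ coinvariants π) (n : V ⊗[k] A) :
    (π : A →ₗ[k] B).lTensor (V ⊗[k] A) (hopfTwist (TensorProduct.mk k V A) (comulTwo k r) n) ∈
      LinearMap.range (((coinvariants π).subtype.lTensor V).rTensor B) := by
  induction n with
  | zero => simp
  | add s t hs ht => simpa only [map_add] using add_mem hs ht
  | tmul v x =>
    obtain ⟨t, ht⟩ := lTensor_sandwich_mem π hr x
    have h1 (s : A ⊗[k] A) : (π : A →ₗ[k] B).lTensor (V ⊗[k] A)
        ((TensorProduct.assoc k V A A).symm (v ⊗ₜ s)) =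
          (TensorProduct.assoc k V A B).symm (v ⊗ₜ (π : A →ₗ[k] B).lTensor A s) := by
      induction s with
      | zero => simp
      | add s t hs ht => simp only [TensorProduct.tmul_add, map_add, hs, ht]
      | tmul a b => simp
    have h2 (s : coinvariants π ⊗[k] B) : ((coinvariants π).subtype.lTensor V).rTensor B
        ((TensorProduct.assoc k V (coinvariants π) B).symm (v ⊗ₜ s)) =
          (TensorProduct.assoc k V A B).symm (v ⊗ₜ (coinvariants π).subtype.rTensor B s) := by
      induction s with
      | zero => simp
      | add s t hs ht => simp only [TensorProduct.tmul_add, map_add, hs, ht]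
      | tmul a b => simp
    exact ⟨(TensorProduct.assoc k V (coinvariants π) B).symm (v ⊗ₜ t), by
      rw [h2, ht, hopfTwist_mk_tmul, h1]⟩

namespace YetterDrinfeld

/-- The functor induced by a projection of Hopf algebras sends free modules to free modules. -/
theorem IsFree.inducedFunctor_obj (hπ : ∀ b, π (ι b) = b) {X : YetterDrinfeld k A}
    (hX : X.IsFree) : ((inducedFunctor ι π hπ).obj X).IsFree := by
  obtain ⟨V, E, hact, hco⟩ := hX
  let i : V.carrier ⊗[k] coinvariants π →ₗ[k] X.carrier :=
    E.toLinearMap ∘ₗ (coinvariants π).subtype.lTensor V.carrier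
  have hi : Function.Injective i := E.injective.comp
    (Module.Flat.lTensor_preserves_injective_linearMap _ (coinvariants π).injective_subtype)
  have hmem (u) : (π : A →ₗ[k] B).lTensor X.carrier (X.coact (i u)) ∈
      LinearMap.range (i.rTensor B) := by
    induction u with
    | zero => simp
    | add s t hs ht => simpa only [map_add] using add_mem hs ht
    | tmul v r =>
      obtain ⟨t, ht⟩ := lTensor_hopfTwist_mk_mem π r.2 (V.coact v)
      refine ⟨t, ?_⟩
      change _ = (π : A →ₗ[k] B).lTensor X.carrier (X.coact (E (v ⊗ₜ r.1)))
      rw [hco, lTensor_rTensor_comm, ← ht, ← LinearMap.rTensor_comp_apply]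
  let Y := (inducedFunctor ι π hπ).obj X
  -- The generating comodule over `B` is `V ⊗ R`: `(V ⊗ R) ⊗ B ≅ V ⊗ (R ⊗ B) ≅ V ⊗ A ≅ X`.
  let e : (V.carrier ⊗[k] coinvariants π) ⊗[k] B ≃ₗ[k] X.carrier :=
    (TensorProduct.assoc k _ _ _).trans (((coinvEquiv ι π hπ).lTensor V.carrier).trans E)
  have he (u b) : e (u ⊗ₜ b) = X.act (i u) (ι b) := by
    induction u with
    | zero => simp
    | add s t hs ht => simp only [map_add, LinearMap.add_apply, TensorProduct.add_tmul, hs, ht]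
    | tmul v r => simp [e, i, hact, coinvEquiv_tmul]
  exact isFree_of_colinear (Y.toRightComodule.restrict i hi hmem) i
    (Y.toRightComodule.rTensor_coact_restrict i hi hmem) e he

end YetterDrinfeld

end Projection

end

theorem mainTheorem9 {k A B : Type u} [Field k] [Ring A] [HopfAlgebra k A]
    [Ring B] [HopfAlgebra k B] (ι : B →ₐc[k] A) (π : A →ₐc[k] B) (hπ : ∀ b, π (ι b) = b)
    (hA : IsCosemisimple k A) :
    gsDim k B ≤ gsDim k A ∧
      ∀ X : YetterDrinfeld k A, X.IsFree →
        ((YetterDrinfeld.inducedFunctor ι π hπ).obj X).IsFree := by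
  have h := fun X : YetterDrinfeld k A => YetterDrinfeld.IsFree.inducedFunctor_obj ι π hπ (X := X)
  exact ⟨YetterDrinfeld.gsDim_le_of_isFree_inducedFunctor ι π hπ hA h, h⟩
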